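/- **Setting.** Let $d\in\{2,3\}$ and let $\Omega\subset\mathbb R^d$ be a bounded open set with $\Omega=\operatorname{int}\overline\Omega$ (for instance a bounded Lipschitz domain with polygonal boundary). Let $\tau_h$ be a conforming triangulation of $\Omega$ into nondegenerate triangles (tetrahedra), $h=\max_{K\in\tau_h}\operatorname{diam}K$. It is shape regular with constant $\sigma$ if every $K\in\tau_h$ contains a ball of radius $r>0$ with $\operatorname{diam}K\le\sigma r$, and quasiuniform with constant $q$ if $h\le q\operatorname{diam}K$ for all $K\in\tau_h$. For $p\ge1$ let $V_h$ be the space of continuous functions on $\overline\Omega$ that vanish on $\partial\Omega$ and are polynomials of degree $\le p$ on every $K\in\tau_h$, let $\psi_1,\dots,\psi_n$ be its Lagrange nodal basis, belonging to the nodes $x_1,\dots,x_n\in\Omega$ of the principal lattices of order $p$, and let $I_hg=\sum_kg(x_k)\psi_k$. A set $\omega\subset\Omega$ is resolved by $\tau_h$ if it is the interior of a union of elements; then $V_h(\omega)=\{v|_\omega:v\in V_h\}$ and $V_{h,0}(\omega)=\{v\in V_h:\operatorname{supp}v\subset\overline\omega\}$. Let $A$ be a measurable matrix-valued coefficient on $\Omega$,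 almost everywhere symmetric and such that $\alpha|\zeta|^2\le A(x)\zeta\cdot\zeta\le\beta|\zeta|^2$ for all $\zeta\in\mathbb R^d$ and almost all $x$, where $0<\alpha\le\beta$. Put $a_D(u,v)=\int_DA\nabla u\cdot\nabla v\,dx$ and $a=a_\Omega$. The stiffness matrix is $\mathbf A=(a(\psi_i,\psi_j))_{i,j}$. Let $\omega_i\subset\omega_i^*$, $i=1,\dots,M$, be open sets resolved by $\tau_h$ with $\bigcup_i\omega_i=\Omega$, and let $\xi$ (resp. $\xi^*$) be the maximal number of sets $\omega_i$ (resp. $\omega_i^*$) containing a common point of $\Omega$. Let $\chi_i$ be a partition of unity subordinate to $\{\omega_i\}$: continuous functions on $\Omega$ with $\operatorname{supp}\chi_i\subset\overline{\omega_i}$, $0\le\chi_i\le1$, $\sum_i\chi_i=1$, $\chi_i\in W^{1,\infty}(\omega_i)$ and $\|\nabla\chi_i\|_{L^\infty(\omega_i)}\le C_\chi/\operatorname{diam}\omega_i$ for some $C_\chi$. Put $\chi_{h,i}v=I_h(\chi_iv)$ for $v\in V_h(\omega_i)$. Let $V_{h,A}(\omega_i^*)$ consist of the $v\in V_h(\omega_i^*)$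 with $a_{\omega_i^*}(v,w)=0$ for all $w\in V_{h,0}(\omega_i^*)$. For each $i$ let $\phi_{i,1},\phi_{i,2},\dots$ be a basis of $V_{h,A}(\omega_i^*)$ consisting of eigenfunctions of $$a_{\omega_i}\big(\chi_{h,i}(\phi|_{\omega_i}),\chi_{h,i}(v|_{\omega_i})\big)=\lambda\,a_{\omega_i^*}(\phi,v)\qquad\forall v\in V_{h,A}(\omega_i^*),$$ with eigenvalues $\lambda_{i,1}\ge\lambda_{i,2}\ge\dots$ in $[0,\infty]$, where $\lambda=\infty$ means that $a_{\omega_i^*}(\phi,v)=0$ for all $v\in V_{h,A}(\omega_i^*)$. Choose $0\le m_i\le\dim V_{h,A}(\omega_i^*)$ and let $$S=\Big\{\sum_i\chi_{h,i}(\phi_i):\phi_i\in\operatorname{span}\{\phi_{i,1}|_{\omega_i},\dots,\phi_{i,m_i}|_{\omega_i}\}\Big\},\qquad \Lambda=\Big(\xi\,\xi^*\max_i\lambda_{i,m_i+1}\Big)^{1/2},$$ with $\lambda_{i,m_i+1}=0$ if $m_i=\dim V_{h,A}(\omega_i^*)$. Fix bases of the spaces $V_{h,0}(\omega_i^*)$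 and $S$. Let $\widetilde{\mathbf R}_i^T$ and $\mathbf R_S^T$ be the matrices of the embeddings $V_{h,0}(\omega_i^*)\to V_h$ and $S\to V_h$ with respect to these bases and $\{\psi_k\}$, and let $\widetilde{\mathbf R}_i^T\widetilde{\boldsymbol\chi}_i$ be the matrix of $V_{h,0}(\omega_i^*)\to V_h$, $v\mapsto\chi_{h,i}(v|_{\omega_i})$. Put $\widetilde{\mathbf A}_i=\widetilde{\mathbf R}_i\mathbf A\widetilde{\mathbf R}_i^T$, $\mathbf A_S=\mathbf R_S\mathbf A\mathbf R_S^T$, $\mathbf Q=\sum_i\widetilde{\mathbf R}_i^T\widetilde{\boldsymbol\chi}_i\widetilde{\mathbf A}_i^{-1}\widetilde{\mathbf R}_i$ and $$\mathbf B=\mathbf Q+\mathbf R_S^T\mathbf A_S^{-1}\mathbf R_S(\mathbf I-\mathbf A\mathbf Q).$$ For a linear functional $\ell$ on $V_h$ let $\mathbf A\mathbf u=\mathbf f$ with $\mathbf f=(\ell(\psi_i))_i$. GMRES, with the Euclidean norm $\|\cdot\|$ on $\mathbb R^n$, applied to $\mathbf B\mathbf A\mathbf u=\mathbf B\mathbf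 f$ with initial vector $\mathbf u^0$ produces iterates $\mathbf u^j\in\mathbf u^0+\mathcal K_j$ that minimize $\|\mathbf B\mathbf A(\mathbf u-\mathbf v)\|$ over $\mathbf v\in\mathbf u^0+\mathcal K_j$, where $\mathcal K_j=\operatorname{span}\{(\mathbf B\mathbf A)^l(\mathbf u-\mathbf u^0):1\le l\le j\}$. **Corollary 3.7.** Let $d,\Omega,p,\sigma,q$ be as above and let $\Lambda_0<1$. There is a constant $C>0$, depending only on $d,\Omega,p,\sigma,q,\Lambda_0$, such that the following holds for every triangulation $\tau_h$ of $\Omega$ that is shape regular with constant $\sigma$ and quasiuniform with constant $q$, and for all data $A,\alpha,\beta,M,\omega_i,\omega_i^*,\chi_i,\phi_{i,j},m_i$ as above with $\Lambda\le\Lambda_0$. There is an integer $k\ge0$ with $$k\le C\Big(\log\frac\beta\alpha+\max\{1,\log(h^{-1})\}\Big)$$ such that for all $\ell$, all initial vectors $\mathbf u^0$, all GMRES iterates $\mathbf u^j$ and all $j\ge0$, $$\|\mathbf B\mathbf A(\mathbf u-\mathbf u^{j+k})\|\le\Lambda^j\,\|\mathbf B\mathbf A(\mathbf u-\mathbf u^0)\|.$$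 -/

import Mathlib

open MeasureTheory
open scoped Matrix ENNReal

noncomputable section

namespace MSGFEM

/-- Euclidean space of dimension `d`. -/
abbrev E (d : ℕ) : Type := EuclideanSpace ℝ (Fin d)

/-- The closed simplex with vertex set `K`. -/
def cell {d : ℕ} (K : Finset (E d)) : Set (E d) := convexHull ℝ (K : Set (E d))

/-- A conforming triangulation of `Ω` into nondegenerate closed `d`-simplices (triangles for
`d = 2`, tetrahedra for `d = 3`), each recorded by its set of `d + 1` vertices. -/
structure Triangulation {d : ℕ} (Ω : Set (E d)) where
  cells : Finset (Finset (E d))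
  card_eq : ∀ K ∈ cells, K.card = d + 1
  affineIndependent : ∀ K ∈ cells, AffineIndependent ℝ (fun x : K => (x : E d))
  cover : (⋃ K ∈ cells, cell K) = closure Ω
  conforming : ∀ K ∈ cells, ∀ L ∈ cells,
    cell K ∩ cell L ⊆ convexHull ℝ ((K : Set (E d)) ∩ (L : Set (E d)))

namespace Triangulation

variable {d : ℕ} {Ω : Set (E d)}

/-- The mesh size `h`, the largest diameter of an element. -/
def meshSize (T : Triangulation Ω) : ℝ := ⨆ K : T.cells, Metric.diam (cell (K : Finset (E d)))

/-- Shape regularity with constant `σ`: every element contains a ball of radius `r` with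
`diam K ≤ σ r`. -/
def ShapeRegular (T : Triangulation Ω) (σ : ℝ) : Prop :=
  ∀ K ∈ T.cells, ∃ x : E d, ∃ r : ℝ, 0 < r ∧ Metric.closedBall x r ⊆ cell K ∧
    Metric.diam (cell K) ≤ σ * r

/-- Quasiuniformity with constant `q`: all diameters are comparable to the mesh size. -/
def QuasiUniform (T : Triangulation Ω) (q : ℝ) : Prop :=
  ∀ K ∈ T.cells, T.meshSize ≤ q * Metric.diam (cell K)

/-- The finite element space `V_h`: continuous functions that are polynomials of degree at most
`p` on every element and vanish on the boundary. They are regarded as functions on the whole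
space, extended by zero outside `Ω`. -/
def Vh (T : Triangulation Ω) (p : ℕ) : Submodule ℝ (E d → ℝ) where
  carrier := {v | Continuous v ∧ (∀ x, x ∉ Ω → v x = 0) ∧
    ∀ K ∈ T.cells, ∃ P : MvPolynomial (Fin d) ℝ, P.totalDegree ≤ p ∧
      ∀ x ∈ cell K, v x = MvPolynomial.eval (fun i => x i) P}
  zero_mem' := by
    refine ⟨continuous_const, fun _ _ => rfl, fun K _ => ⟨0, by simp, fun x _ => by simp⟩⟩
  add_mem' := by
    rintro u v ⟨hu, hu0, hup⟩ ⟨hv, hv0, hvp⟩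
    refine ⟨hu.add hv, fun x hx => by simp [hu0 x hx, hv0 x hx], fun K hK => ?_⟩
    obtain ⟨P, hP, hPe⟩ := hup K hK
    obtain ⟨Q, hQ, hQe⟩ := hvp K hK
    exact ⟨P + Q, (MvPolynomial.totalDegree_add P Q).trans (max_le hP hQ),
      fun x hx => by simp [hPe x hx, hQe x hx]⟩
  smul_mem' := by
    rintro c v ⟨hv, hv0, hvp⟩
    refine ⟨hv.const_smul c, fun x hx => by simp [hv0 x hx], fun K hK => ?_⟩
    obtain ⟨P, hP, hPe⟩ := hvp K hK
    exact ⟨c • P, (MvPolynomial.totalDegree_smul_le c P).trans hP,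
      fun x hx => by simp [hPe x hx, MvPolynomial.smul_eval]⟩

/-- The Lagrange nodes of degree `p` that lie in `Ω`: points of the principal lattices of the
elements, i.e. with barycentric coordinates in `{0, 1/p, …, 1}`. -/
def interiorNodes (T : Triangulation Ω) (p : ℕ) : Set (E d) :=
  {x | x ∈ Ω ∧ ∃ K ∈ T.cells, ∃ m : E d → ℕ, ∑ v ∈ K, m v = p ∧
    x = ∑ v ∈ K, ((m v : ℝ) / (p : ℝ)) • v}

/-- `ω` is resolved by the mesh: it is the open set made up of a collection of elements. -/
def Resolves (T : Triangulation Ω) (ω : Set (E d)) : Prop :=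
  ∃ S ⊆ T.cells, ω = interior (⋃ K ∈ S, cell K)

/-- `V_{h,0}(ω)`: the functions of `V_h` with support in the closure of `ω`. -/
def Vh0 (T : Triangulation Ω) (p : ℕ) (ω : Set (E d)) : Submodule ℝ (T.Vh p) where
  carrier := {v | ∀ x, x ∉ closure ω → (v : E d → ℝ) x = 0}
  zero_mem' := fun _ _ => rfl
  add_mem' := fun {u v} hu hv x hx => by simp [hu x hx, hv x hx]
  smul_mem' := fun c v hv x hx => by simp [hv x hx]

end Triangulation

/-- Restriction of functions to `ω`. A function on `ω` is represented by its extension by zero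
to the whole space. -/
def restr {d : ℕ} (ω : Set (E d)) : (E d → ℝ) →ₗ[ℝ] (E d → ℝ) where
  toFun v := ω.indicator v
  map_add' u v := Set.indicator_add ω u v
  map_smul' c v := Set.indicator_const_smul ω c v

/-- The Lagrange nodal basis `ψ_1, …, ψ_n` of `V_h`, together with the enumeration of the nodes. -/
structure NodalBasis {d : ℕ} {Ω : Set (E d)} (T : Triangulation Ω) (p n : ℕ) where
  node : Fin n ≃ T.interiorNodes p
  basis : Module.Basis (Fin n) ℝ (T.Vh p)
  basis_node : ∀ k l, (basis k : E d → ℝ) (node l) = if k = l then 1 else 0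

/-- Lagrange interpolation `I_h g = ∑ g(x_k) ψ_k`. -/
def NodalBasis.interp {d : ℕ} {Ω : Set (E d)} {T : Triangulation Ω} {p n : ℕ}
    (Ψ : NodalBasis T p n) : (E d → ℝ) →ₗ[ℝ] T.Vh p where
  toFun g := ∑ k, g (Ψ.node k) • Ψ.basis k
  map_add' f g := by simp [add_smul, Finset.sum_add_distrib]
  map_smul' c g := by simp [mul_smul, Finset.smul_sum]

/-- The coefficient: measurable, symmetric and uniformly elliptic with bounds `α ≤ β`
(and therefore essentially bounded). -/
structure IsElliptic {d : ℕ} (Ω : Set (E d)) (A : E d → Matrix (Fin d) (Fin d) ℝ)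
    (α β : ℝ) : Prop where
  pos : 0 < α
  le : α ≤ β
  aemeasurable : ∀ i j, AEMeasurable (fun x => A x i j) (volume.restrict Ω)
  symm : ∀ᵐ x ∂(volume.restrict Ω), (A x).IsSymm
  bounds : ∀ᵐ x ∂(volume.restrict Ω), ∀ ζ : Fin d → ℝ,
    α * (ζ ⬝ᵥ ζ) ≤ (A x *ᵥ ζ) ⬝ᵥ ζ ∧ (A x *ᵥ ζ) ⬝ᵥ ζ ≤ β * (ζ ⬝ᵥ ζ)

/-- The gradient, as the vector of partial derivatives. For piecewise polynomials it exists almost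
everywhere and is the weak gradient. -/
def grad {d : ℕ} (u : E d → ℝ) (x : E d) : Fin d → ℝ :=
  fun i => fderiv ℝ u x (EuclideanSpace.single i 1)

/-- The bilinear form `a_D(u, v) = ∫_D A ∇u · ∇v`. -/
def form {d : ℕ} (A : E d → Matrix (Fin d) (Fin d) ℝ) (D : Set (E d)) (u v : E d → ℝ) : ℝ :=
  ∫ x in D, (A x *ᵥ grad u x) ⬝ᵥ grad v x

/-- Overlapping subdomains `ω_i`, oversampling domains `ω_i^*`, and a partition of unity. -/
structure Decomposition {d : ℕ} {Ω : Set (E d)} (T : Triangulation Ω) (M : ℕ) where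
  ω : Fin M → Set (E d)
  ωs : Fin M → Set (E d)
  resolves : ∀ i, T.Resolves (ω i)
  resolves_s : ∀ i, T.Resolves (ωs i)
  cover : (⋃ i, ω i) = Ω
  subset : ∀ i, ω i ⊆ ωs i
  χ : Fin M → E d → ℝ
  continuousOn : ∀ i, ContinuousOn (χ i) Ω
  supp : ∀ i, ∀ x ∈ Ω, χ i x ≠ 0 → x ∈ closure (ω i)
  nonneg : ∀ i, ∀ x ∈ Ω, 0 ≤ χ i x
  le_one : ∀ i, ∀ x ∈ Ω, χ i x ≤ 1
  sum_eq_one : ∀ x ∈ Ω, ∑ i, χ i x = 1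
  Cχ : ℝ
  /- `χ_i ∈ W^{1,∞}(ω_i)` with `‖∇χ_i‖_∞ ≤ Cχ / diam ω_i`, as a local Lipschitz bound. -/
  lipschitz : ∀ i, ∀ (c : E d) (r : ℝ), Metric.ball c r ⊆ ω i →
    ∀ y ∈ Metric.ball c r, ∀ z ∈ Metric.ball c r,
      |χ i y - χ i z| ≤ Cχ / Metric.diam (ω i) * dist y z

/-- The maximal number of sets of the family `ω` that contain a common point of `Ω`. -/
def overlap {d M : ℕ} (Ω : Set (E d)) (ω : Fin M → Set (E d)) : ℕ :=
  sSup {c : ℕ | ∃ x ∈ Ω, c = {i : Fin M | x ∈ ω i}.ncard}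

section Method

variable {d : ℕ} {Ω : Set (E d)} {T : Triangulation Ω} {p n M : ℕ}

/-- The partition of unity operator `χ_{h,i} v = I_h(χ_i v)`, for functions `v` on `ω_i`. -/
def pou (Ψ : NodalBasis T p n) (D : Decomposition T M) (i : Fin M) :
    (E d → ℝ) →ₗ[ℝ] T.Vh p :=
  Ψ.interp ∘ₗ LinearMap.mulLeft ℝ (D.χ i)

/-- The discrete `a`-harmonic functions on `ω`: the restrictions to `ω` of functions of `V_h` that
are `a_ω`-orthogonal to `V_{h,0}(ω)`. -/
def harmonic (T : Triangulation Ω) (p : ℕ) (A : E d → Matrix (Fin d) (Fin d) ℝ)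
    (ω : Set (E d)) : Set (E d → ℝ) :=
  {v | v ∈ (T.Vh p).map (restr ω) ∧ ∀ w ∈ T.Vh0 p ω, form A ω v (w : T.Vh p) = 0}

/-- `(μ, φ)` with `μ ∈ [0, ∞]` is an eigenpair of the local eigenproblem
`a_{ω_i}(χ_{h,i} φ, χ_{h,i} v) = μ a_{ω_i^*}(φ, v)` for all `a`-harmonic `v` on `ω_i^*`; for
`μ = ∞` this says that `a_{ω_i^*}(φ, v) = 0` for all such `v`. -/
def IsEigenpair (Ψ : NodalBasis T p n) (A : E d → Matrix (Fin d) (Fin d) ℝ)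
    (D : Decomposition T M) (i : Fin M) (μ : ℝ≥0∞) (φ : E d → ℝ) : Prop :=
  φ ∈ harmonic T p A (D.ωs i) ∧ ∀ v ∈ harmonic T p A (D.ωs i),
    (μ = ⊤ → form A (D.ωs i) φ v = 0) ∧
    (μ ≠ ⊤ → form A (D.ω i) (pou Ψ D i (restr (D.ω i) φ)) (pou Ψ D i (restr (D.ω i) v)) =
      μ.toReal * form A (D.ωs i) φ v)

/-- A complete system of eigenfunctions of each local eigenproblem, arranged by decreasing
eigenvalue (with multiplicity), and the number `m i` of eigenfunctions that are selected. -/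
structure EigenSystem (Ψ : NodalBasis T p n) (A : E d → Matrix (Fin d) (Fin d) ℝ)
    (D : Decomposition T M) where
  N : Fin M → ℕ
  φ : ∀ i, Fin (N i) → E d → ℝ
  lam : ∀ i, Fin (N i) → ℝ≥0∞
  antitone : ∀ i, Antitone (lam i)
  linearIndependent : ∀ i, LinearIndependent ℝ (φ i)
  span_eq : ∀ i, (Submodule.span ℝ (Set.range (φ i)) : Set (E d → ℝ)) =
    harmonic T p A (D.ωs i)
  eigen : ∀ i j, IsEigenpair Ψ A D i (lam i j) (φ i j)
  m : Fin M → ℕ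
  m_le : ∀ i, m i ≤ N i

namespace EigenSystem

variable {Ψ : NodalBasis T p n} {A : E d → Matrix (Fin d) (Fin d) ℝ} {D : Decomposition T M}

/-- `λ_{i, m_i + 1}`, the first eigenvalue that is not selected (`0` if all are selected). -/
def lamNext (S : EigenSystem Ψ A D) (i : Fin M) : ℝ≥0∞ :=
  if h : S.m i < S.N i then S.lam i ⟨S.m i, h⟩ else 0

/-- `Λ = (ξ ξ^* max_i λ_{i, m_i + 1})^{1/2}`. -/
def Lam (S : EigenSystem Ψ A D) : ℝ≥0∞ :=
  ((overlap Ω D.ω : ℝ≥0∞) * (overlap Ω D.ωs : ℝ≥0∞) * ⨆ i, S.lamNext i) ^ (1 / 2 : ℝ)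

/-- The local approximation space `S_{m_i}(ω_i)`. -/
def localSpace (S : EigenSystem Ψ A D) (i : Fin M) : Submodule ℝ (E d → ℝ) :=
  Submodule.span ℝ {v | ∃ j : Fin (S.N i), (j : ℕ) < S.m i ∧ v = restr (D.ω i) (S.φ i j)}

/-- The coarse space `S_m(Ω)` of all sums `∑ χ_{h,i} φ_i` with `φ_i ∈ S_{m_i}(ω_i)`. -/
def coarseSpace (S : EigenSystem Ψ A D) : Submodule ℝ (T.Vh p) :=
  ⨆ i, (S.localSpace i).map (pou Ψ D i)

end EigenSystem

/-- The stiffness matrix. -/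
def stiffness (Ψ : NodalBasis T p n) (A : E d → Matrix (Fin d) (Fin d) ℝ) :
    Matrix (Fin n) (Fin n) ℝ :=
  Matrix.of fun i j => form A Ω (Ψ.basis i) (Ψ.basis j)

/-- `Rᵀ`: the matrix of the embedding of a subspace `W` of `V_h`, for a basis of `W`. -/
def extMatrix (Ψ : NodalBasis T p n) {W : Submodule ℝ (T.Vh p)} {r : ℕ}
    (w : Module.Basis (Fin r) ℝ W) : Matrix (Fin n) (Fin r) ℝ :=
  LinearMap.toMatrix w Ψ.basis W.subtype

/-- `R̃ᵢᵀ χ̃ᵢ`: the matrix of `v ↦ χ_{h,i}(v|_{ω_i})`, viewed as a map from `V_{h,0}(ω_i^*)`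
into `V_h`. -/
def pouMatrix (Ψ : NodalBasis T p n) (D : Decomposition T M) (i : Fin M) {r : ℕ}
    (w : Module.Basis (Fin r) ℝ (T.Vh0 p (D.ωs i))) : Matrix (Fin n) (Fin r) ℝ :=
  LinearMap.toMatrix w Ψ.basis
    (pou Ψ D i ∘ₗ restr (D.ω i) ∘ₗ (T.Vh p).subtype ∘ₗ (T.Vh0 p (D.ωs i)).subtype)

/-- The one-level part `∑ R̃ᵢᵀ χ̃ᵢ Ãᵢ⁻¹ R̃ᵢ` with `Ãᵢ = R̃ᵢ A R̃ᵢᵀ`. -/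
def oneLevel (Ψ : NodalBasis T p n) (A : E d → Matrix (Fin d) (Fin d) ℝ)
    (D : Decomposition T M) {r : Fin M → ℕ}
    (w : ∀ i, Module.Basis (Fin (r i)) ℝ (T.Vh0 p (D.ωs i))) : Matrix (Fin n) (Fin n) ℝ :=
  ∑ i, pouMatrix Ψ D i (w i) *
    ((extMatrix Ψ (w i))ᵀ * stiffness Ψ A * extMatrix Ψ (w i))⁻¹ * (extMatrix Ψ (w i))ᵀ

/-- The two-level hybrid restricted additive Schwarz preconditioner
`B = Q + (R_Sᵀ A_S⁻¹ R_S) (I - A Q)`, where `Q` is the one-level part and `A_S = R_S A R_Sᵀ`. -/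
def preconditioner (Ψ : NodalBasis T p n) (A : E d → Matrix (Fin d) (Fin d) ℝ)
    (D : Decomposition T M) (S : EigenSystem Ψ A D) {r : Fin M → ℕ}
    (w : ∀ i, Module.Basis (Fin (r i)) ℝ (T.Vh0 p (D.ωs i))) {s : ℕ}
    (wS : Module.Basis (Fin s) ℝ S.coarseSpace) : Matrix (Fin n) (Fin n) ℝ :=
  oneLevel Ψ A D w +
    (extMatrix Ψ wS * ((extMatrix Ψ wS)ᵀ * stiffness Ψ A * extMatrix Ψ wS)⁻¹ *
      (extMatrix Ψ wS)ᵀ) * (1 - stiffness Ψ A * oneLevel Ψ A D w)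

end Method

/-- The Euclidean norm of a coefficient vector. -/
def eucl {n : ℕ} (x : Fin n → ℝ) : ℝ := ‖WithLp.toLp 2 x‖

/-- The Krylov space spanned by `G e, G² e, …, Gʲ e`. -/
def krylov {n : ℕ} (G : Matrix (Fin n) (Fin n) ℝ) (e : Fin n → ℝ) (j : ℕ) :
    Submodule ℝ (Fin n → ℝ) :=
  Submodule.span ℝ {x | ∃ l : ℕ, 1 ≤ l ∧ l ≤ j ∧ x = (G ^ l) *ᵥ e}

/-- `U 0, U 1, …` are GMRES iterates (for the Euclidean norm) for the system with matrix `G` and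
solution `u`, started at `U 0`: the iterate `U j` minimizes `‖G (u - v)‖` over `v ∈ U 0 + K_j`. -/
def IsGMRES {n : ℕ} (G : Matrix (Fin n) (Fin n) ℝ) (u : Fin n → ℝ) (U : ℕ → Fin n → ℝ) : Prop :=
  ∀ j, U j - U 0 ∈ krylov G (u - U 0) j ∧
    ∀ v, v - U 0 ∈ krylov G (u - U 0) j → eucl (G *ᵥ (u - U j)) ≤ eucl (G *ᵥ (u - v))

end MSGFEM

end

/-! Write G = BA. The algebra of the preconditioner gives 1 - G = (1 - P_S)(1 - QA), with P_S the
energy projection onto the coarse space. For v in V_h let u_i be its energy projection onto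
V_{h,0}(ω_i^*). Then v - u_i is a-harmonic on ω_i^*, and the partition of unity gives v - ∑ χ_{h,i}
u_i = ∑ χ_{h,i}(v - u_i). Expand each v - u_i in the local eigenfunctions: the part with eigenvalues
above λ_{i,m_i+1} is mapped into S, and the rest costs a factor λ_{i,m_i+1} in energy. Summing with
the overlaps ξ and ξ^* shows that 1 - G contracts the energy norm by Λ
(`EigenSystem.exists_coarse_approx`, `energy_contraction`).

GMRES minimizes the Euclidean norm instead. The residual polynomial (1 - t)^(j+k) is admissible, so
changing norms costs the square root of c₂/c₁, where c₁ and c₂ are spectral bounds of the stiffness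
matrix; k extra steps with (c₂/c₁) Λ^(2k) ≤ 1 pay for it (`IsGMRES.eucl_le`). Only log(c₂/c₁) enters
k, so any bound of the form const · (β/α) · h^(-N) is good enough (`exists_nat_absorbing`).

The crude bound used here has N = 2d + 2. The upper bound c₂ comes from a sup-norm inverse estimate
(`Triangulation.dist_le_of_mem_Vh`, `IsElliptic.form_le_eucl_sq`); the lower bound c₁ from the same
estimate, Friedrichs' inequality and a count of the nodes (`IsElliptic.eucl_sq_le_form`). The
inverse estimate rests on an explicit Lagrange basis on the principal lattice
(`eval_eq_sum_latticePoly`). -/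

noncomputable section

namespace MSGFEM

/-! ### Lattice polynomials and their span -/

/-- The product of falling factorials `∏ i, t i (t i - 1) ⋯ (t i - m i + 1)`. -/
def latticePoly {ι : Type*} [Fintype ι] (m : ι → ℕ) (t : ι → ℝ) : ℝ :=
  ∏ i, ∏ j ∈ Finset.range (m i), (t i - j)

theorem latticePoly_add_single {ι : Type*} [Fintype ι] [DecidableEq ι] (m : ι → ℕ) (j : ι)
    (t : ι → ℝ) :
    latticePoly (m + Pi.single j 1) t = (t j - m j) * latticePoly m t := by
  unfold latticePoly
  rw [← Finset.mul_prod_erase _ _ (Finset.mem_univ j),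
    ← Finset.mul_prod_erase (a := j) Finset.univ
      (fun i => ∏ j ∈ Finset.range (m i), (t i - j)) (Finset.mem_univ j)]
  have : ∏ x ∈ Finset.univ.erase j, ∏ k ∈ Finset.range ((m + Pi.single j 1 : ι → ℕ) x), (t x - k) =
      ∏ x ∈ Finset.univ.erase j, ∏ k ∈ Finset.range (m x), (t x - k) := by
    refine Finset.prod_congr rfl fun x hx => ?_
    have hx' : x ≠ j := (Finset.mem_erase.1 hx).1
    simp [Pi.single_eq_of_ne hx']
  rw [this]
  simp only [Pi.add_apply, Pi.single_eq_same, Finset.prod_range_succ]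
  ring

theorem latticePoly_natCast_self {ι : Type*} [Fintype ι] (m : ι → ℕ) :
    latticePoly m (fun i => (m i : ℝ)) = ∏ i, ((m i).factorial : ℝ) := by
  unfold latticePoly
  refine Finset.prod_congr rfl fun i _ => ?_
  rw [← Finset.prod_range_reflect, ← Finset.prod_range_add_one_eq_factorial]
  push_cast
  refine Finset.prod_congr rfl fun j hj => ?_
  have := Finset.mem_range.1 hj
  rw [Nat.cast_sub (by omega), Nat.cast_sub (by omega)]
  push_cast; ring

/-- Two different multi-indices of equal sum have a component with m' i < m i, and the factor t i -
m' i then vanishes. With `latticePoly_natCast_self` this makes the lattice polynomials, up to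
factorials, dual to evaluation at the lattice points. -/
theorem latticePoly_natCast_of_ne {ι : Type*} [Fintype ι] (m m' : ι → ℕ)
    (h : ∑ i, m i = ∑ i, m' i) (hne : m ≠ m') :
    latticePoly m (fun i => (m' i : ℝ)) = 0 := by
  have : ∃ i, m' i < m i := by
    by_contra! hle
    exact hne (funext fun i =>
      (Finset.sum_eq_sum_iff_of_le fun i _ => hle i).1 h i (Finset.mem_univ i))
  obtain ⟨i, hi⟩ := this
  exact Finset.prod_eq_zero (Finset.mem_univ i)
    (Finset.prod_eq_zero (Finset.mem_range.2 hi) (sub_self _))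

theorem abs_prod_sub_prod_le {κ : Type*} (s : Finset κ) (f g : κ → ℝ) (B δ : ℝ) (hB : 1 ≤ B)
    (hδ : 0 ≤ δ) (hf : ∀ i ∈ s, |f i| ≤ B) (hg : ∀ i ∈ s, |g i| ≤ B)
    (hfg : ∀ i ∈ s, |f i - g i| ≤ δ) :
    |∏ i ∈ s, f i - ∏ i ∈ s, g i| ≤ s.card * B ^ s.card * δ := by
  classical
  induction s using Finset.induction_on with
  | empty => simp
  | insert a s ha ih =>
    have ih' := ih (fun i hi => hf i (Finset.mem_insert_of_mem hi))
      (fun i hi => hg i (Finset.mem_insert_of_mem hi))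
      (fun i hi => hfg i (Finset.mem_insert_of_mem hi))
    have hgs : |∏ i ∈ s, g i| ≤ B ^ s.card := by
      rw [Finset.abs_prod]
      refine (Finset.prod_le_prod (fun i _ => abs_nonneg _)
        fun i hi => hg i (Finset.mem_insert_of_mem hi)).trans ?_
      simp
    have hfa := hf a (Finset.mem_insert_self a s)
    have hfga := hfg a (Finset.mem_insert_self a s)
    have hpos : (0 : ℝ) ≤ B ^ s.card := by positivity
    rw [Finset.prod_insert ha, Finset.prod_insert ha, Finset.card_insert_of_notMem ha]
    have e : f a * ∏ i ∈ s, f i - g a * ∏ i ∈ s, g i =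
        f a * (∏ i ∈ s, f i - ∏ i ∈ s, g i) + (f a - g a) * ∏ i ∈ s, g i := by ring
    rw [e]
    refine (abs_add_le _ _).trans ?_
    rw [abs_mul, abs_mul]
    have h1 : |f a| * |∏ i ∈ s, f i - ∏ i ∈ s, g i| ≤ B * (s.card * B ^ s.card * δ) :=
      mul_le_mul hfa ih' (abs_nonneg _) (by positivity)
    have h2 : |f a - g a| * |∏ i ∈ s, g i| ≤ δ * B ^ s.card :=
      mul_le_mul hfga hgs (abs_nonneg _) hδ
    have h3 : δ * B ^ s.card ≤ δ * B ^ s.card * B :=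
      le_mul_of_one_le_right (by positivity) hB
    push_cast
    rw [pow_succ]
    nlinarith

/-- There are |m| = p factors, each of size at most p on the simplex 0 ≤ t i ≤ p, so telescoping the
product gives the constant. -/
theorem abs_latticePoly_sub_le {ι : Type*} [Fintype ι] (m : ι → ℕ) (p : ℕ) (hp : 1 ≤ p)
    (hm : ∑ i, m i = p) (s t : ι → ℝ) (hs : ∀ i, 0 ≤ s i ∧ s i ≤ p)
    (ht : ∀ i, 0 ≤ t i ∧ t i ≤ p) (δ : ℝ) (hδ : 0 ≤ δ) (hst : ∀ i, |s i - t i| ≤ δ) :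
    |latticePoly m s - latticePoly m t| ≤ p * (p : ℝ) ^ p * δ := by
  unfold latticePoly
  rw [Finset.prod_sigma', Finset.prod_sigma']
  have hcard : (Finset.univ.sigma fun i => Finset.range (m i)).card = p := by
    simp [Finset.card_sigma, hm]
  have hmi : ∀ i, m i ≤ p := fun i => hm ▸ Finset.single_le_sum (fun _ _ => Nat.zero_le _)
    (Finset.mem_univ i)
  have key : ∀ r : ι → ℝ, (∀ i, 0 ≤ r i ∧ r i ≤ p) →
      ∀ x ∈ (Finset.univ.sigma fun i => Finset.range (m i)), |r x.1 - (x.2 : ℝ)| ≤ p := by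
    intro r hr x hx
    have h1 : x.2 < m x.1 := by simpa using hx
    have h2 : (x.2 : ℝ) ≤ p := by exact_mod_cast (h1.le.trans (hmi x.1))
    have h3 : (0 : ℝ) ≤ x.2 := Nat.cast_nonneg _
    obtain ⟨h4, h5⟩ := hr x.1
    rw [abs_le]
    constructor <;> linarith
  have := abs_prod_sub_prod_le (Finset.univ.sigma fun i => Finset.range (m i))
    (fun x => s x.1 - (x.2 : ℝ)) (fun x => t x.1 - (x.2 : ℝ)) p δ (by exact_mod_cast hp) hδ
    (key s hs) (key t ht) (fun x _ => by simpa using hst x.1)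
  rwa [hcard] at this

section Span

variable {ι X : Type*} [Fintype ι] [DecidableEq ι]

/-- The span of the functions `latticePoly m ∘ t` with `|m| = q`. -/
def latticeSpan (t : X → ι → ℝ) (q : ℕ) : Submodule ℝ (X → ℝ) :=
  Submodule.span ℝ (Set.range fun (m : Finset.piAntidiag (Finset.univ : Finset ι) q) (x : X) =>
    latticePoly (m : ι → ℕ) (t x))

theorem latticePoly_mem_latticeSpan (t : X → ι → ℝ) {q : ℕ} (m : ι → ℕ) (hm : ∑ i, m i = q) :
    (fun x => latticePoly m (t x)) ∈ latticeSpan t q :=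
  Submodule.subset_span ⟨⟨m, by simp [Finset.mem_piAntidiag, hm]⟩, rfl⟩

theorem sum_add_single (m : ι → ℕ) (j : ι) :
    ∑ i, (m + Pi.single j 1 : ι → ℕ) i = ∑ i, m i + 1 := by
  simp [Finset.sum_add_distrib]

/-- Summing the recursion `latticePoly_add_single` over j multiplies by ∑ (t j - m j) = p - q, a
nonzero constant. -/
theorem latticeSpan_le_succ (t : X → ι → ℝ) (p : ℕ) (ht : ∀ x, ∑ i, t x i = p) {q : ℕ}
    (hq : q < p) : latticeSpan t q ≤ latticeSpan t (q + 1) := by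
  refine Submodule.span_le.2 ?_
  rintro _ ⟨⟨m, hm⟩, rfl⟩
  have hm' : ∑ i, m i = q := (Finset.mem_piAntidiag.1 hm).1
  have hpq : (p : ℝ) - q ≠ 0 := sub_ne_zero.2 (by exact_mod_cast hq.ne')
  have : (fun x => latticePoly m (t x)) =
      ((p : ℝ) - q)⁻¹ • ∑ j, fun x => latticePoly (m + Pi.single j 1) (t x) := by
    funext x
    simp only [Pi.smul_apply, Finset.sum_apply, smul_eq_mul, latticePoly_add_single]
    rw [← Finset.sum_mul, Finset.sum_sub_distrib, ht, ← Nat.cast_sum, hm',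
      inv_mul_cancel_left₀ hpq]
  change (fun x => latticePoly m (t x)) ∈ _
  rw [this]
  exact Submodule.smul_mem _ _ (Submodule.sum_mem _ fun j _ =>
    latticePoly_mem_latticeSpan t _ (by rw [sum_add_single, hm']))

/-- By the recursion, t j times the polynomial of m is the polynomial of m + e_j plus m j times that
of m; the second summand is lifted by one degree with `latticeSpan_le_succ`. -/
theorem coord_mul_mem_latticeSpan (t : X → ι → ℝ) (p : ℕ) (ht : ∀ x, ∑ i, t x i = p) {q : ℕ}
    (hq : q < p) (j : ι) {f : X → ℝ} (hf : f ∈ latticeSpan t q) :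
    (fun x => t x j * f x) ∈ latticeSpan t (q + 1) := by
  induction hf using Submodule.span_induction with
  | mem f hf =>
    obtain ⟨⟨m, hm⟩, rfl⟩ := hf
    have hm' : ∑ i, m i = q := (Finset.mem_piAntidiag.1 hm).1
    have : (fun x => t x j * latticePoly m (t x)) =
        (fun x => latticePoly (m + Pi.single j 1) (t x)) +
          (m j : ℝ) • fun x => latticePoly m (t x) := by
      funext x
      simp only [Pi.add_apply, Pi.smul_apply, smul_eq_mul, latticePoly_add_single]
      ring
    change (fun x => t x j * latticePoly m (t x)) ∈ _
    rw [this]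
    exact Submodule.add_mem _ (latticePoly_mem_latticeSpan t _ (by rw [sum_add_single, hm']))
      (Submodule.smul_mem _ _ (latticeSpan_le_succ t p ht hq
        (latticePoly_mem_latticeSpan t _ hm')))
  | zero =>
    convert Submodule.zero_mem (latticeSpan t (q + 1)) using 1
    funext x; simp
  | add f g _ _ hf hg =>
    convert Submodule.add_mem _ hf hg using 1
    funext x; simp [mul_add]
  | smul c f _ hf =>
    convert Submodule.smul_mem _ c hf using 1
    funext x; simp only [Pi.smul_apply, smul_eq_mul]; ring

theorem pow_mul_mem_latticeSpan (t : X → ι → ℝ) (p : ℕ) (ht : ∀ x, ∑ i, t x i = p)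
    (c : ι → ℝ) (e : ℕ) {q : ℕ} (hq : q + e ≤ p) {f : X → ℝ} (hf : f ∈ latticeSpan t q) :
    (fun x => (∑ i, c i * t x i) ^ e * f x) ∈ latticeSpan t (q + e) := by
  induction e with
  | zero => simpa using hf
  | succ e ih =>
    have ih' := ih (by omega)
    have : (fun x => (∑ i, c i * t x i) ^ (e + 1) * f x) =
        ∑ j, c j • fun x => t x j * ((∑ i, c i * t x i) ^ e * f x) := by
      funext x
      simp only [Finset.sum_apply, Pi.smul_apply, smul_eq_mul]
      rw [pow_succ', mul_assoc, Finset.sum_mul]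
      exact Finset.sum_congr rfl fun j _ => mul_assoc _ _ _
    rw [this, ← add_assoc]
    exact Submodule.sum_mem _ fun j _ => Submodule.smul_mem _ _
      (coord_mul_mem_latticeSpan t p ht (by omega) j ih')

theorem latticeSpan_le_add (t : X → ι → ℝ) (p : ℕ) (ht : ∀ x, ∑ i, t x i = p) {q : ℕ} (e : ℕ)
    (hq : q + e ≤ p) : latticeSpan t q ≤ latticeSpan t (q + e) := by
  induction e with
  | zero => exact le_rfl
  | succ e ih =>
    exact (ih (by omega)).trans (latticeSpan_le_succ t p ht (by omega))

/-- Polynomials of degree at most `p` are combinations of the lattice polynomials of order `p`. -/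
theorem eval_mem_latticeSpan {κ : Type*} [Fintype κ] (t : X → ι → ℝ) (p : ℕ)
    (ht : ∀ x, ∑ i, t x i = p) (y : X → κ → ℝ) (c : κ → ι → ℝ)
    (hy : ∀ x k, y x k = ∑ i, c k i * t x i) (P : MvPolynomial κ ℝ) (hP : P.totalDegree ≤ p) :
    (fun x => MvPolynomial.eval (y x) P) ∈ latticeSpan t p := by
  classical
  have e1 : (fun x => MvPolynomial.eval (y x) P) =
      ∑ s ∈ P.support, P.coeff s • fun x => ∏ k, (y x k) ^ s k := by
    funext x
    simp [MvPolynomial.eval_eq']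
  rw [e1]
  refine Submodule.sum_mem _ fun s hs => Submodule.smul_mem _ _ ?_
  have hdeg : ∑ k, s k ≤ p := by
    have := (MvPolynomial.le_totalDegree hs).trans hP
    rwa [Finsupp.sum_fintype _ _ (fun _ => rfl)] at this
  -- Each coordinate is a linear form in t, so a monomial can be built one variable at a time,
  -- raising the lattice degree by the exponent. At the end the degree is lifted to p.
  have key : ∀ A : Finset κ, ∑ k ∈ A, s k ≤ p →
      (fun x => ∏ k ∈ A, (y x k) ^ s k) ∈ latticeSpan t (∑ k ∈ A, s k) := by
    intro A
    induction A using Finset.induction_on with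
    | empty =>
      intro _
      have := latticePoly_mem_latticeSpan t (q := 0) (0 : ι → ℕ) (by simp)
      simpa [latticePoly] using this
    | insert a A ha ih =>
      intro hA
      rw [Finset.sum_insert ha] at hA ⊢
      simp only [Finset.prod_insert ha, hy]
      rw [add_comm]
      have h2 := pow_mul_mem_latticeSpan t p ht (c a) (s a) (by omega) (ih (by omega))
      simpa only [hy] using h2
  have h1 := key Finset.univ hdeg
  obtain ⟨e, he⟩ := Nat.exists_eq_add_of_le hdeg
  rw [he]
  exact latticeSpan_le_add t (∑ k, s k + e) (by simpa [he] using ht) e le_rfl h1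

end Span

/-! ### Interpolation and inverse estimate on one simplex -/

/-- The point of the principal lattice of order `p` with barycentric coordinates `m / p`. -/
def latticeNode {ι : Type*} [Fintype ι] {d : ℕ} (a : ι → E d) (p : ℕ) (m : ι → ℕ) : E d :=
  ∑ i, ((m i : ℝ) / p) • a i

theorem coord_sum_smul {ι : Type*} [Fintype ι] {d : ℕ} (b : AffineBasis ι ℝ (E d)) (w : ι → ℝ)
    (hw : ∑ i, w i = 1) (i : ι) : b.coord i (∑ i, w i • b i) = w i := by
  rw [← Finset.affineCombination_eq_linear_combination Finset.univ b w hw]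
  exact b.coord_apply_combination_of_mem (Finset.mem_univ i) hw

/-- Lagrange interpolation on the principal lattice reproduces polynomials of degree at most
`p`. -/
theorem eval_eq_sum_latticePoly {ι : Type*} [Fintype ι] [DecidableEq ι] {d : ℕ}
    (b : AffineBasis ι ℝ (E d)) (p : ℕ) (hp : 1 ≤ p) (P : MvPolynomial (Fin d) ℝ)
    (hP : P.totalDegree ≤ p) (x : E d) :
    MvPolynomial.eval (fun i => x i) P =
      ∑ m ∈ Finset.piAntidiag (Finset.univ : Finset ι) p,
        MvPolynomial.eval (fun i => latticeNode b p m i) P / (∏ i, ((m i).factorial : ℝ)) *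
          latticePoly m (fun i => p * b.coord i x) := by
  have hp0 : (p : ℝ) ≠ 0 := by positivity
  have h := eval_mem_latticeSpan (fun (x : E d) i => (p : ℝ) * b.coord i x) p
    (fun x => by rw [← Finset.mul_sum, b.sum_coord_apply_eq_one, mul_one])
    (fun (x : E d) k => x k) (fun k i => b i k / p)
    (fun x k => by
      conv_lhs => rw [← b.linear_combination_coord_eq_self x]
      simp only [WithLp.ofLp_sum, WithLp.ofLp_smul, Finset.sum_apply, Pi.smul_apply, smul_eq_mul]
      refine Finset.sum_congr rfl fun i _ => ?_
      field_simp) P hP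
  obtain ⟨c, hc⟩ := (Submodule.mem_span_range_iff_exists_fun ℝ).1 h
  have hc' : ∀ x : E d, MvPolynomial.eval (fun i => x i) P =
      ∑ m : Finset.piAntidiag (Finset.univ : Finset ι) p,
        c m * latticePoly (m : ι → ℕ) (fun i => p * b.coord i x) := fun x => by
    have := congrFun hc x
    simp only [Finset.sum_apply, Pi.smul_apply, smul_eq_mul] at this
    exact this.symm
  rw [← Finset.sum_coe_sort, hc' x]
  refine Finset.sum_congr rfl fun m _ => ?_
  congr 1
  have hm : ∀ m : Finset.piAntidiag (Finset.univ : Finset ι) p, ∑ i, (m : ι → ℕ) i = p :=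
    fun m => (Finset.mem_piAntidiag.1 m.2).1
  have hcoord : (fun i => (p : ℝ) * b.coord i (latticeNode b p m)) =
      fun i => ((m : ι → ℕ) i : ℝ) := by
    funext i
    unfold latticeNode
    rw [coord_sum_smul b]
    · field_simp
    · rw [← Finset.sum_div, ← Nat.cast_sum, hm m, div_self hp0]
  -- The coefficient of m is read off at the lattice node of m, where all other lattice polynomials
  -- vanish.
  rw [hc' (latticeNode b p m), hcoord, Finset.sum_eq_single m]
  · rw [latticePoly_natCast_self, mul_div_assoc, div_self, mul_one]
    exact Finset.prod_ne_zero_iff.2 fun i _ => by positivity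
  · intro m' _ hne
    rw [latticePoly_natCast_of_ne _ _ ((hm m').trans (hm m).symm)
      (fun h => hne (Subtype.ext h)), mul_zero]
  · simp

/-- A barycentric coordinate is affine with values in [0, 1] on the ball, so a step of length r from
the centre changes it by at most 1; its linear part therefore has norm at most 1 / r. -/
theorem abs_coord_sub_le {ι : Type*} [Fintype ι] {d : ℕ} (b : AffineBasis ι ℝ (E d)) {c : E d}
    {r : ℝ} (hr : 0 < r) (hball : Metric.closedBall c r ⊆ convexHull ℝ (Set.range b)) (i : ι)
    (x y : E d) : |b.coord i x - b.coord i y| ≤ dist x y / r := by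
  have hmem : ∀ z ∈ Metric.closedBall c r, 0 ≤ b.coord i z ∧ b.coord i z ≤ 1 := by
    intro z hz
    have h := hball hz
    rw [b.convexHull_eq_nonneg_coord] at h
    refine ⟨h i, ?_⟩
    rw [← b.sum_coord_apply_eq_one z]
    exact Finset.single_le_sum (f := fun i => b.coord i z) (fun j _ => h j) (Finset.mem_univ i)
  have hlin : b.coord i x - b.coord i y = (b.coord i).linear (x - y) := by
    simpa using ((b.coord i).linearMap_vsub x y).symm
  rcases eq_or_ne x y with rfl | hxy
  · simp
  have hd : 0 < dist x y := dist_pos.2 hxy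
  set u : E d := (r / dist x y) • (x - y) with hu
  have hu1 : ‖u‖ = r := by
    rw [hu, norm_smul, ← dist_eq_norm, Real.norm_of_nonneg (by positivity)]
    field_simp
  have h1 := hmem (c + u) (by simp [hu1])
  have h2 := hmem c (by simp [hr.le])
  have h3 : b.coord i (c + u) - b.coord i c = (r / dist x y) * (b.coord i x - b.coord i y) := by
    have := (b.coord i).linearMap_vsub (c + u) c
    simp only [vsub_eq_sub, add_sub_cancel_left] at this
    rw [← this, hlin, hu, map_smul, smul_eq_mul]
  have h4 : |(r / dist x y) * (b.coord i x - b.coord i y)| ≤ 1 := by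
    rw [← h3, abs_le]; constructor <;> linarith [h1.1, h1.2, h2.1, h2.2]
  rw [abs_mul, abs_of_pos (by positivity)] at h4
  rw [le_div_iff₀ hr]
  rw [div_mul_eq_mul_div, div_le_one hd] at h4
  linarith

/-- The constant of the inverse estimate on a simplex. -/
def inverseConst (d p : ℕ) : ℝ := (p + 1 : ℝ) ^ (d + 1) * (p * (p : ℝ) ^ p * p)

theorem inverseConst_pos (d : ℕ) {p : ℕ} (hp : 1 ≤ p) : 0 < inverseConst d p := by
  unfold inverseConst; positivity

theorem one_le_inverseConst (d : ℕ) {p : ℕ} (hp : 1 ≤ p) : 1 ≤ inverseConst d p := by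
  have h : (1 : ℝ) ≤ p := by exact_mod_cast hp
  unfold inverseConst
  have h1 : (1 : ℝ) ≤ (p + 1 : ℝ) ^ (d + 1) := one_le_pow₀ (by linarith)
  have h2 : (1 : ℝ) ≤ (p : ℝ) ^ p := one_le_pow₀ h
  have h3 : (1 : ℝ) ≤ p * (p : ℝ) ^ p := one_le_mul_of_one_le_of_one_le h h2
  exact one_le_mul_of_one_le_of_one_le h1 (one_le_mul_of_one_le_of_one_le h3 h)

/-- Inverse estimate on a simplex that contains a ball of radius `r`. -/
theorem abs_eval_sub_eval_le {ι : Type*} [Fintype ι] [DecidableEq ι] {d : ℕ}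
    (b : AffineBasis ι ℝ (E d)) (hι : Fintype.card ι = d + 1) (p : ℕ) (hp : 1 ≤ p)
    (P : MvPolynomial (Fin d) ℝ) (hP : P.totalDegree ≤ p) {c : E d} {r : ℝ} (hr : 0 < r)
    (hball : Metric.closedBall c r ⊆ convexHull ℝ (Set.range b)) (B : ℝ) (hB : 0 ≤ B)
    (hnode : ∀ m : ι → ℕ, ∑ i, m i = p →
      |MvPolynomial.eval (fun i => latticeNode b p m i) P| ≤ B)
    {x y : E d} (hx : x ∈ convexHull ℝ (Set.range b)) (hy : y ∈ convexHull ℝ (Set.range b)) :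
    |MvPolynomial.eval (fun i => x i) P - MvPolynomial.eval (fun i => y i) P| ≤
      inverseConst d p * B / r * dist x y := by
  rw [eval_eq_sum_latticePoly b p hp P hP x, eval_eq_sum_latticePoly b p hp P hP y,
    ← Finset.sum_sub_distrib]
  have hmem : ∀ z ∈ convexHull ℝ (Set.range b), ∀ i, 0 ≤ p * b.coord i z ∧
      p * b.coord i z ≤ p := by
    intro z hz i
    rw [b.convexHull_eq_nonneg_coord] at hz
    refine ⟨mul_nonneg (Nat.cast_nonneg _) (hz i), mul_le_of_le_one_right (Nat.cast_nonneg _) ?_⟩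
    rw [← b.sum_coord_apply_eq_one z]
    exact Finset.single_le_sum (f := fun i => b.coord i z) (fun j _ => hz j) (Finset.mem_univ i)
  -- The nodal value contributes B, the product of factors contributes p · p^p, and the last p comes
  -- from the scaling of the barycentric coordinates to [0, p].
  have hterm : ∀ m ∈ Finset.piAntidiag (Finset.univ : Finset ι) p,
      |MvPolynomial.eval (fun i => latticeNode b p m i) P / (∏ i, ((m i).factorial : ℝ)) *
          latticePoly m (fun i => p * b.coord i x) -
        MvPolynomial.eval (fun i => latticeNode b p m i) P / (∏ i, ((m i).factorial : ℝ)) *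
          latticePoly m (fun i => p * b.coord i y)| ≤
        B * (p * (p : ℝ) ^ p * (p * (dist x y / r))) := by
    intro m hm
    have hm' : ∑ i, m i = p := (Finset.mem_piAntidiag.1 hm).1
    rw [← mul_sub, abs_mul]
    refine mul_le_mul ?_ ?_ (abs_nonneg _) hB
    · have h1 : (1 : ℝ) ≤ ∏ i, ((m i).factorial : ℝ) := by
        exact_mod_cast Nat.succ_le_of_lt (Finset.prod_pos fun i _ => Nat.factorial_pos (m i))
      rw [abs_div, abs_of_pos (lt_of_lt_of_le one_pos h1)]
      exact (div_le_self (abs_nonneg _) h1).trans (hnode m hm')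
    · refine abs_latticePoly_sub_le m p hp hm' _ _ (hmem x hx) (hmem y hy) _ (by positivity) ?_
      intro i
      rw [← mul_sub, abs_mul, Nat.abs_cast]
      exact mul_le_mul_of_nonneg_left (abs_coord_sub_le b hr hball i x y) (Nat.cast_nonneg _)
  have hcard : ((Finset.piAntidiag (Finset.univ : Finset ι) p).card : ℝ) ≤
      (p + 1 : ℝ) ^ (d + 1) := by
    have : (Finset.piAntidiag (Finset.univ : Finset ι) p).card ≤ (p + 1) ^ (d + 1) := by
      refine (Finset.card_le_card (t := Fintype.piFinset fun _ : ι => Finset.range (p + 1))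
        fun m hm => ?_).trans (by simp [hι])
      have hm' : ∑ i, m i = p := (Finset.mem_piAntidiag.1 hm).1
      refine Fintype.mem_piFinset.2 fun i => Finset.mem_range.2 (Nat.lt_succ_of_le ?_)
      exact hm' ▸ Finset.single_le_sum (fun _ _ => Nat.zero_le _) (Finset.mem_univ i)
    exact_mod_cast this
  refine (Finset.abs_sum_le_sum_abs _ _).trans ((Finset.sum_le_sum hterm).trans ?_)
  rw [Finset.sum_const, nsmul_eq_mul]
  refine (mul_le_mul_of_nonneg_right hcard (by positivity)).trans (le_of_eq ?_)
  unfold inverseConst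
  ring

/-- Go from a to the last point t of a piece that contains a. That piece is not needed on the rest
of the interval, so induction on the number of pieces applies. The pieces need not be intervals. -/
theorem abs_sub_le_of_finset_cover {κ : Type*} (s : Finset κ) (C : κ → Set ℝ)
    (hC : ∀ k, IsClosed (C k)) (g : ℝ → ℝ) (L : ℝ)
    (hg : ∀ k, ∀ x ∈ C k, ∀ y ∈ C k, |g x - g y| ≤ L * |x - y|) (a b : ℝ) (hab : a ≤ b)
    (hcov : Set.Icc a b ⊆ ⋃ k ∈ s, C k) : |g a - g b| ≤ L * (b - a) := by
  classical
  induction hn : s.card generalizing s a with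
  | zero =>
    rw [Finset.card_eq_zero] at hn
    subst hn
    simpa using hcov (Set.left_mem_Icc.2 hab)
  | succ n ih =>
    obtain ⟨k, hk, hak⟩ := Set.mem_iUnion₂.1 (hcov (Set.left_mem_Icc.2 hab))
    have hcomp : IsCompact (Set.Icc a b ∩ C k) := isCompact_Icc.inter_right (hC k)
    have hne : (Set.Icc a b ∩ C k).Nonempty := ⟨a, Set.left_mem_Icc.2 hab, hak⟩
    obtain ⟨t, ⟨⟨hat, htb⟩, htk⟩, hmax⟩ := hcomp.exists_isGreatest hne
    have h1 : |g a - g t| ≤ L * (t - a) := by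
      have := hg k a hak t htk
      rwa [abs_sub_comm a t, abs_of_nonneg (sub_nonneg.2 hat)] at this
    rcases htb.eq_or_lt with rfl | htb'
    · exact h1
    have hclosed : IsClosed (⋃ k' ∈ s.erase k, C k') :=
      Set.Finite.isClosed_biUnion (Finset.finite_toSet (s.erase k)) fun k' _ => hC k'
    have h2 : Set.Icc t b ⊆ ⋃ k' ∈ s.erase k, C k' := by
      -- Points beyond t lie in other pieces by maximality of t; the point t itself does so because
      -- a finite union of closed sets is closed.
      rw [← closure_Ioc htb'.ne]
      refine hclosed.closure_subset_iff.2 fun z hz => ?_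
      obtain ⟨k', hk', hz'⟩ := Set.mem_iUnion₂.1 (hcov ⟨hat.trans hz.1.le, hz.2⟩)
      refine Set.mem_iUnion₂.2 ⟨k', Finset.mem_erase.2 ⟨?_, hk'⟩, hz'⟩
      rintro rfl
      exact absurd (hmax ⟨⟨hat.trans hz.1.le, hz.2⟩, hz'⟩) (not_le.2 hz.1)
    have h3 := ih (s.erase k) t htb'.le h2 (by rw [Finset.card_erase_of_mem hk, hn]; rfl)
    have h4 := abs_sub_le (g a) (g t) (g b)
    linarith

/-! ### Geometry of the mesh and Lipschitz bounds on V_h -/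

namespace Triangulation

variable {d : ℕ} {Ω : Set (E d)}

theorem exists_affineBasis (T : Triangulation Ω) {K : Finset (E d)} (hK : K ∈ T.cells) :
    ∃ b : AffineBasis K ℝ (E d), (b : K → E d) = Subtype.val := by
  refine ⟨⟨fun x : K => (x : E d), T.affineIndependent K hK, ?_⟩, rfl⟩
  rw [(T.affineIndependent K hK).affineSpan_eq_top_iff_card_eq_finrank_add_one]
  simp [T.card_eq K hK]

theorem isCompact_cell (K : Finset (E d)) : IsCompact (cell K) :=
  (Finset.finite_toSet K).isCompact_convexHull ℝ

theorem isClosed_cell (K : Finset (E d)) : IsClosed (cell K) := (isCompact_cell K).isClosed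

theorem interior_cell_nonempty (T : Triangulation Ω) {K : Finset (E d)} (hK : K ∈ T.cells) :
    (interior (cell K)).Nonempty := by
  unfold cell
  rw [interior_convexHull_nonempty_iff_affineSpan_eq_top]
  obtain ⟨b, hb⟩ := T.exists_affineBasis hK
  have := b.tot
  rw [hb] at this
  simpa using this

theorem closure_interior_cell (T : Triangulation Ω) {K : Finset (E d)} (hK : K ∈ T.cells) :
    closure (interior (cell K)) = cell K := by
  have h : Convex ℝ (cell K) := convex_convexHull ℝ (K : Set (E d))
  rw [h.closure_interior_eq_closure_of_nonempty_interior (T.interior_cell_nonempty hK)]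
  exact (isClosed_cell K).closure_eq

/-- A closed cell is the closure of its interior, so the two interiors meet. By conformity the hull
of the common vertices then has interior points, which forces d + 1 common vertices. -/
theorem eq_of_interior_cell_inter_nonempty (T : Triangulation Ω) {K L : Finset (E d)}
    (hK : K ∈ T.cells) (hL : L ∈ T.cells) (h : (interior (cell K) ∩ cell L).Nonempty) :
    K = L := by
  classical
  obtain ⟨x, hxK, hxL⟩ := h
  rw [← T.closure_interior_cell hL] at hxL
  have h1 : (interior (cell K) ∩ interior (cell L)).Nonempty :=
    mem_closure_iff.1 hxL _ isOpen_interior hxK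
  have h2 : (interior (convexHull ℝ ((K ∩ L : Finset (E d)) : Set (E d)))).Nonempty := by
    refine h1.mono (interior_maximal ?_ (isOpen_interior.inter isOpen_interior))
    rw [Finset.coe_inter]
    exact (Set.inter_subset_inter interior_subset interior_subset).trans
      (T.conforming K hK L hL)
  rw [interior_convexHull_nonempty_iff_affineSpan_eq_top] at h2
  have hind : AffineIndependent ℝ (fun x : (K ∩ L : Finset (E d)) => (x : E d)) :=
    (T.affineIndependent K hK).mono (s := ((K ∩ L : Finset (E d)) : Set (E d)))
      (t := (K : Set (E d))) (by simp)
  have h3 : (K ∩ L).card = d + 1 := by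
    have := (hind.affineSpan_eq_top_iff_card_eq_finrank_add_one).1
      (by rw [← h2]; congr 1; exact Subtype.range_coe)
    simpa using this
  have h4 : K ∩ L = K := Finset.eq_of_subset_of_card_le Finset.inter_subset_left
    (by rw [h3, T.card_eq K hK])
  have h5 : K ∩ L = L := Finset.eq_of_subset_of_card_le Finset.inter_subset_right
    (by rw [h3, T.card_eq L hL])
  exact h4.symm.trans h5

theorem latticeNode_mem_cell {K : Finset (E d)} (b : AffineBasis K ℝ (E d))
    (hb : (b : K → E d) = Subtype.val) {p : ℕ} (hp : 1 ≤ p) {m : K → ℕ} (hm : ∑ i, m i = p) :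
    latticeNode b p m ∈ cell K := by
  have hp0 : (p : ℝ) ≠ 0 := by positivity
  have : cell K = convexHull ℝ (Set.range b) := by simp [cell, hb]
  rw [this, b.convexHull_eq_nonneg_coord]
  intro i
  unfold latticeNode
  rw [coord_sum_smul b _ (by rw [← Finset.sum_div, ← Nat.cast_sum, hm, div_self hp0])]
  positivity

theorem latticeNode_mem_interiorNodes (T : Triangulation Ω) {K : Finset (E d)} (hK : K ∈ T.cells)
    (b : AffineBasis K ℝ (E d)) (hb : (b : K → E d) = Subtype.val) {p : ℕ} {m : K → ℕ}
    (hm : ∑ i, m i = p) (hΩ : latticeNode b p m ∈ Ω) :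
    latticeNode b p m ∈ T.interiorNodes p := by
  classical
  refine ⟨hΩ, K, hK, fun x => if h : x ∈ K then m ⟨x, h⟩ else 0, ?_, ?_⟩
  · rw [← Finset.sum_coe_sort]; simpa using hm
  · rw [← Finset.sum_coe_sort]; simp [latticeNode, hb]

/-- A function of `V_h` is Lipschitz on every element, with a constant proportional to the size of
its nodal values. -/
theorem abs_sub_le_of_mem_cell (T : Triangulation Ω) {p : ℕ} (hp : 1 ≤ p) {v : E d → ℝ}
    (hv : v ∈ T.Vh p) {K : Finset (E d)} (hK : K ∈ T.cells) {c : E d} {r : ℝ} (hr : 0 < r)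
    (hball : Metric.closedBall c r ⊆ cell K) (B : ℝ) (hB : 0 ≤ B)
    (hnode : ∀ x ∈ T.interiorNodes p, x ∈ cell K → |v x| ≤ B) {x y : E d} (hx : x ∈ cell K)
    (hy : y ∈ cell K) : |v x - v y| ≤ inverseConst d p * B / r * dist x y := by
  classical
  obtain ⟨b, hb⟩ := T.exists_affineBasis hK
  obtain ⟨-, hv0, hvP⟩ := hv
  obtain ⟨P, hP, hPe⟩ := hvP K hK
  have hcell : cell K = convexHull ℝ (Set.range b) := by simp [cell, hb]
  rw [hPe x hx, hPe y hy]
  rw [hcell] at hball hx hy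
  refine abs_eval_sub_eval_le b (by simp [T.card_eq K hK]) p hp P hP hr hball B hB ?_ hx hy
  intro m hm
  have hmem := latticeNode_mem_cell b hb hp hm
  rw [← hPe _ hmem]
  by_cases hΩ : latticeNode b p m ∈ Ω
  · exact hnode _ (T.latticeNode_mem_interiorNodes hK b hb hm hΩ) hmem
  · rw [hv0 _ hΩ]; simpa using hB

/-- The lattice nodes outside Ω impose nothing new, since v vanishes there anyway. -/
theorem eq_zero_of_mem_cell (T : Triangulation Ω) {p : ℕ} (hp : 1 ≤ p) {v : E d → ℝ}
    (hv : v ∈ T.Vh p) {K : Finset (E d)} (hK : K ∈ T.cells)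
    (hnode : ∀ x ∈ T.interiorNodes p, x ∈ cell K → v x = 0) {x : E d} (hx : x ∈ cell K) :
    v x = 0 := by
  classical
  obtain ⟨b, hb⟩ := T.exists_affineBasis hK
  obtain ⟨-, hv0, hvP⟩ := hv
  obtain ⟨P, hP, hPe⟩ := hvP K hK
  rw [hPe x hx, eval_eq_sum_latticePoly b p hp P hP x]
  refine Finset.sum_eq_zero fun m hm => ?_
  have hm' : ∑ i, m i = p := (Finset.mem_piAntidiag.1 hm).1
  have hmem := latticeNode_mem_cell b hb hp hm'
  have : v (latticeNode b p m) = 0 := by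
    by_cases hΩ : latticeNode b p m ∈ Ω
    · exact hnode _ (T.latticeNode_mem_interiorNodes hK b hb hm' hΩ) hmem
    · exact hv0 _ hΩ
  rw [← hPe _ hmem, this, zero_div, zero_mul]

/-- Global Lipschitz estimate for functions of `V_h`. -/
theorem dist_le_of_mem_Vh (T : Triangulation Ω) (hΩ : IsOpen Ω) {p : ℕ} (hp : 1 ≤ p)
    {v : E d → ℝ} (hv : v ∈ T.Vh p) {r : ℝ} (hr : 0 < r)
    (hball : ∀ K ∈ T.cells, ∃ c, Metric.closedBall c r ⊆ cell K) (B : ℝ) (hB : 0 ≤ B)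
    (hnode : ∀ x ∈ T.interiorNodes p, |v x| ≤ B) (x y : E d) :
    |v x - v y| ≤ inverseConst d p * B / r * dist x y := by
  classical
  have hL : 0 ≤ inverseConst d p * B / r := by
    have := inverseConst_pos d hp
    positivity
  let γ : ℝ → E d := fun t => AffineMap.lineMap x y t
  have hγ : Continuous γ := AffineMap.lineMap_continuous
  have hγd : ∀ s t, dist (γ s) (γ t) = |s - t| * dist x y := fun s t => by
    simp only [γ, dist_lineMap_lineMap, Real.dist_eq]
  -- The segment from x to y may leave Ω. The piece `none` collects the parameters outside Ω, where
  -- v is zero; the others belong to the cells.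
  let C : Option T.cells → Set ℝ := fun k => k.elim (γ ⁻¹' Ωᶜ) fun K => γ ⁻¹' cell (K : Finset (E d))
  have h := abs_sub_le_of_finset_cover (Finset.univ : Finset (Option T.cells)) C
    (fun k => by
      cases k with
      | none => exact hΩ.isClosed_compl.preimage hγ
      | some K => exact (isClosed_cell (K : Finset (E d))).preimage hγ)
    (fun t => v (γ t)) (inverseConst d p * B / r * dist x y)
    (fun k s hs t ht => by
      cases k with
      | none =>
        have h1 : v (γ s) = 0 := hv.2.1 _ hs
        have h2 : v (γ t) = 0 := hv.2.1 _ ht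
        rw [h1, h2]; simp; positivity
      | some K =>
        obtain ⟨c, hc⟩ := hball K K.2
        have := T.abs_sub_le_of_mem_cell hp hv K.2 hr hc B hB (fun x hx _ => hnode x hx) hs ht
        rw [hγd] at this
        calc _ ≤ _ := this
          _ = _ := by ring)
    0 1 zero_le_one (fun t _ => by
      by_cases ht : γ t ∈ Ω
      · have h1 := subset_closure ht
        rw [← T.cover] at h1
        obtain ⟨K, hK, hx⟩ := Set.mem_iUnion₂.1 h1
        exact Set.mem_iUnion₂.2 ⟨some ⟨K, hK⟩, Finset.mem_univ _, hx⟩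
      · exact Set.mem_iUnion₂.2 ⟨none, Finset.mem_univ _, ht⟩)
  simpa [γ] using h

theorem Resolves.isOpen {T : Triangulation Ω} {ω : Set (E d)} (h : T.Resolves ω) : IsOpen ω := by
  obtain ⟨S, -, rfl⟩ := h
  exact isOpen_interior

theorem Resolves.subset {T : Triangulation Ω} (hΩ : interior (closure Ω) = Ω) {ω : Set (E d)}
    (h : T.Resolves ω) : ω ⊆ Ω := by
  obtain ⟨S, hS, rfl⟩ := h
  rw [← hΩ, ← T.cover]
  exact interior_mono (Set.biUnion_subset_biUnion_left hS)

theorem isClosed_biUnion_cell (S : Finset (Finset (E d))) : IsClosed (⋃ K ∈ S, cell K) :=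
  Set.Finite.isClosed_biUnion (Finset.finite_toSet S) fun K _ => isClosed_cell K

theorem Resolves.interior_closure {T : Triangulation Ω} {ω : Set (E d)} (h : T.Resolves ω) :
    interior (closure ω) = ω := by
  refine Set.Subset.antisymm ?_ (interior_maximal subset_closure h.isOpen)
  obtain ⟨S, hS, rfl⟩ := h
  exact interior_mono (closure_minimal interior_subset (isClosed_biUnion_cell S))

/-- A boundary point of the union lies in some cell but not in its interior, and the boundary of a
convex set is a null set. -/
theorem Resolves.volume_frontier {T : Triangulation Ω} {ω : Set (E d)} (h : T.Resolves ω) :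
    volume (closure ω \ ω) = 0 := by
  obtain ⟨S, hS, rfl⟩ := h
  have h0 : volume (⋃ K ∈ S, frontier (cell K)) = 0 :=
    (measure_biUnion_null_iff (Finset.countable_toSet S)).2 fun K _ =>
      (convex_convexHull ℝ (K : Set (E d))).addHaar_frontier volume
  refine measure_mono_null ?_ h0
  rintro x ⟨hx1, hx2⟩
  have hx3 := closure_minimal interior_subset (isClosed_biUnion_cell S) hx1
  obtain ⟨K, hK, hxK⟩ := Set.mem_iUnion₂.1 hx3
  refine Set.mem_iUnion₂.2 ⟨K, hK, subset_closure hxK, fun hint => hx2 ?_⟩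
  exact interior_mono (Set.subset_biUnion_of_mem (u := fun K => cell K) hK) hint

/-- A function of `V_h` whose nodal values vanish outside a resolved set is supported in the closure
of that set. -/
theorem Resolves.eq_zero {T : Triangulation Ω} {ω : Set (E d)} (h : T.Resolves ω) {p : ℕ}
    (hp : 1 ≤ p) {v : E d → ℝ} (hv : v ∈ T.Vh p)
    (hnode : ∀ x ∈ T.interiorNodes p, x ∉ ω → v x = 0) {x : E d} (hx : x ∉ closure ω) :
    v x = 0 := by
  have hopen := h.isOpen
  obtain ⟨S, hS, hω⟩ := h
  by_cases hxΩ : x ∈ Ω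
  swap
  · exact hv.2.1 x hxΩ
  have h1 := subset_closure hxΩ
  rw [← T.cover] at h1
  obtain ⟨K, hK, hxK⟩ := Set.mem_iUnion₂.1 h1
  have hKS : K ∉ S := by
    intro hKS
    apply hx
    rw [← T.closure_interior_cell hK] at hxK
    refine closure_mono ?_ hxK
    rw [hω]
    exact interior_mono (Set.subset_biUnion_of_mem (u := fun K => cell K) hKS)
  -- A cell K outside the collection S has no node in ω: otherwise its interior would meet ω, hence
  -- a cell of S, and K would be that cell.
  refine T.eq_zero_of_mem_cell hp hv hK (fun y hy hyK => hnode y hy fun hyω => hKS ?_) hxK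
  rw [← T.closure_interior_cell hK] at hyK
  obtain ⟨z, hz1, hz2⟩ := mem_closure_iff.1 hyK ω hopen hyω
  rw [hω] at hz1
  obtain ⟨L, hL, hzL⟩ := Set.mem_iUnion₂.1 (interior_subset hz1)
  rwa [T.eq_of_interior_cell_inter_nonempty hK (hS hL) ⟨z, hz2, hzL⟩]

end Triangulation

namespace Triangulation

variable {d : ℕ} {Ω : Set (E d)}

theorem exists_closedBall_subset_cell (T : Triangulation Ω) :
    ∃ r : ℝ, 0 < r ∧ ∀ K ∈ T.cells, ∃ c, Metric.closedBall c r ⊆ cell K := by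
  classical
  have key : ∀ S : Finset (Finset (E d)), S ⊆ T.cells →
      ∃ r : ℝ, 0 < r ∧ ∀ K ∈ S, ∃ c, Metric.closedBall c r ⊆ cell K := by
    intro S
    induction S using Finset.induction_on with
    | empty => exact fun _ => ⟨1, one_pos, by simp⟩
    | insert K S _ ih =>
      intro hS
      obtain ⟨r, hr, h⟩ := ih ((Finset.subset_insert K S).trans hS)
      obtain ⟨c, hc⟩ := T.interior_cell_nonempty (hS (Finset.mem_insert_self K S))
      obtain ⟨ε, hε, hb⟩ := Metric.nhds_basis_closedBall.mem_iff.1 (mem_interior_iff_mem_nhds.1 hc)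
      refine ⟨min r ε, lt_min hr hε, fun L hL => ?_⟩
      rcases Finset.mem_insert.1 hL with rfl | hL
      · exact ⟨c, (Metric.closedBall_subset_closedBall (min_le_right _ _)).trans hb⟩
      · obtain ⟨c', hc'⟩ := h L hL
        exact ⟨c', (Metric.closedBall_subset_closedBall (min_le_left _ _)).trans hc'⟩
  exact key T.cells subset_rfl

theorem hasCompactSupport_of_mem_Vh (T : Triangulation Ω) (hb : Bornology.IsBounded Ω) {p : ℕ}
    {v : E d → ℝ} (hv : v ∈ T.Vh p) : HasCompactSupport v :=
  HasCompactSupport.of_support_subset_isCompact hb.isCompact_closure fun x hx =>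
    subset_closure (by_contra fun h => hx (hv.2.1 x h))

/-- A qualitative statement with a mesh-dependent constant. It supplies differentiability almost
everywhere and bounded gradients, hence linearity and integrability in the energy form. -/
theorem exists_lipschitzWith (T : Triangulation Ω) (hΩ : IsOpen Ω) (hb : Bornology.IsBounded Ω)
    {p : ℕ} (hp : 1 ≤ p) {v : E d → ℝ} (hv : v ∈ T.Vh p) : ∃ C, LipschitzWith C v := by
  obtain ⟨r, hr, hball⟩ := T.exists_closedBall_subset_cell
  obtain ⟨B, hB⟩ := (T.hasCompactSupport_of_mem_Vh hb hv).exists_bound_of_continuous hv.1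
  have hB0 : 0 ≤ B := (norm_nonneg _).trans (hB 0)
  have hL : 0 ≤ inverseConst d p * B / r := by
    have := inverseConst_pos d hp
    positivity
  refine ⟨⟨_, hL⟩, LipschitzWith.of_dist_le_mul fun x y => ?_⟩
  exact T.dist_le_of_mem_Vh hΩ hp hv hr hball B hB0 (fun x _ => hB x) x y

end Triangulation

/-! ### Gradients and the energy form -/

section Gradient

variable {d : ℕ}

theorem abs_grad_le {u : E d → ℝ} {C : NNReal} (hu : LipschitzWith C u) (x : E d) (i : Fin d) :
    |grad u x i| ≤ C := by
  have h1 := (fderiv ℝ u x).le_opNorm (EuclideanSpace.single i (1 : ℝ))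
  have h2 := norm_fderiv_le_of_lipschitz ℝ hu (x₀ := x)
  simp only [PiLp.norm_single, norm_one, mul_one, Real.norm_eq_abs] at h1
  exact h1.trans h2

theorem measurable_grad (u : E d → ℝ) : Measurable (grad u) :=
  measurable_pi_lambda _ fun _ => measurable_fderiv_apply_const ℝ u _

theorem grad_congr_of_isOpen {u v : E d → ℝ} {ω : Set (E d)} (hω : IsOpen ω)
    (h : ∀ x ∈ ω, u x = v x) {x : E d} (hx : x ∈ ω) : grad u x = grad v x := by
  have : u =ᶠ[nhds x] v := Filter.eventually_of_mem (hω.mem_nhds hx) h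
  funext i
  simp only [grad, this.fderiv_eq]

theorem grad_add {u v : E d → ℝ} {x : E d} (hu : DifferentiableAt ℝ u x)
    (hv : DifferentiableAt ℝ v x) : grad (u + v) x = grad u x + grad v x := by
  funext i
  simp only [grad, fderiv_add hu hv, Pi.add_apply, add_apply]

theorem grad_smul {u : E d → ℝ} {x : E d} (c : ℝ) (hu : DifferentiableAt ℝ u x) :
    grad (c • u) x = c • grad u x := by
  funext i
  simp only [grad, fderiv_const_smul hu, Pi.smul_apply, smul_apply]

theorem grad_sum {κ : Type*} (s : Finset κ) {u : κ → E d → ℝ} {x : E d}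
    (hu : ∀ i, DifferentiableAt ℝ (u i) x) : grad (∑ i ∈ s, u i) x = ∑ i ∈ s, grad (u i) x := by
  funext j
  simp only [grad, fderiv_sum (u := s) (fun i _ => hu i), Finset.sum_apply,
    sum_apply]

end Gradient

/-- The bilinear form `(g, h) ↦ M g · h`. -/
def matForm {d : ℕ} (M : Matrix (Fin d) (Fin d) ℝ) :
    (Fin d → ℝ) →ₗ[ℝ] (Fin d → ℝ) →ₗ[ℝ] ℝ :=
  LinearMap.mk₂ ℝ (fun g h => (M *ᵥ g) ⬝ᵥ h)
    (fun g g' h => by rw [Matrix.mulVec_add, add_dotProduct])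
    (fun c g h => by rw [Matrix.mulVec_smul, smul_dotProduct])
    (fun g h h' => by rw [dotProduct_add])
    (fun c g h => by rw [dotProduct_smul])

theorem matForm_apply {d : ℕ} (M : Matrix (Fin d) (Fin d) ℝ) (g h : Fin d → ℝ) :
    matForm M g h = (M *ᵥ g) ⬝ᵥ h := rfl

theorem dotProduct_self_nonneg_real {d : ℕ} (g : Fin d → ℝ) : 0 ≤ g ⬝ᵥ g :=
  Finset.sum_nonneg fun i _ => mul_self_nonneg (g i)

theorem matForm_comm {d : ℕ} {M : Matrix (Fin d) (Fin d) ℝ} (hM : M.IsSymm) (g h : Fin d → ℝ) :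
    matForm M g h = matForm M h g := by
  rw [matForm_apply, matForm_apply, dotProduct_comm, Matrix.dotProduct_mulVec,
    ← Matrix.mulVec_transpose, hM.eq]

/-- Expand the nonnegative double sum of B (g i - g j) (g i - g j); the mixed terms add up to the
left side twice, so no symmetry of B is required. -/
theorem bilin_sum_self_le {V κ : Type*} [AddCommGroup V] [Module ℝ V] (B : V →ₗ[ℝ] V →ₗ[ℝ] ℝ)
    (hB : ∀ v, 0 ≤ B v v) (s : Finset κ) (g : κ → V) :
    B (∑ i ∈ s, g i) (∑ i ∈ s, g i) ≤ s.card * ∑ i ∈ s, B (g i) (g i) := by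
  have h0 : 0 ≤ ∑ i ∈ s, ∑ j ∈ s, B (g i - g j) (g i - g j) :=
    Finset.sum_nonneg fun i _ => Finset.sum_nonneg fun j _ => hB _
  have h1 : ∑ i ∈ s, ∑ j ∈ s, B (g i - g j) (g i - g j) =
      2 * (s.card * ∑ i ∈ s, B (g i) (g i)) - 2 * B (∑ i ∈ s, g i) (∑ i ∈ s, g i) := by
    have h2 : B (∑ i ∈ s, g i) (∑ i ∈ s, g i) = ∑ i ∈ s, ∑ j ∈ s, B (g i) (g j) := by
      simp [map_sum, LinearMap.sum_apply]
      rw [Finset.sum_comm]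
    have h3 : B (∑ i ∈ s, g i) (∑ i ∈ s, g i) = ∑ i ∈ s, ∑ j ∈ s, B (g j) (g i) := by
      rw [h2, Finset.sum_comm]
    simp only [map_sub, LinearMap.sub_apply, Finset.sum_sub_distrib, Finset.sum_const,
      nsmul_eq_mul, ← h2, ← h3, ← Finset.mul_sum]
    ring
  linarith

/-- Nonnegativity at g + h and g - h bounds twice the mixed term by the two diagonal ones. The
constant is not sharp; the bound only serves integrability. -/
theorem abs_matForm_le {d : ℕ} {M : Matrix (Fin d) (Fin d) ℝ} {β : ℝ} (hM : M.IsSymm)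
    (h0 : ∀ g, 0 ≤ matForm M g g) (hβ : ∀ g, matForm M g g ≤ β * (g ⬝ᵥ g)) (g h : Fin d → ℝ) :
    |matForm M g h| ≤ β * (g ⬝ᵥ g + h ⬝ᵥ h) := by
  have h1 := h0 (g + h)
  have h2 := h0 (g - h)
  have h3 := hβ g
  have h4 := hβ h
  have h5 := h0 g
  have h6 := h0 h
  simp only [map_add, map_sub, LinearMap.add_apply, LinearMap.sub_apply, matForm_comm hM h g]
    at h1 h2
  rw [abs_le]
  constructor <;> nlinarith

namespace IsElliptic

variable {d : ℕ} {Ω : Set (E d)} {A : E d → Matrix (Fin d) (Fin d) ℝ} {α β : ℝ}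

theorem integrableOn (hA : IsElliptic Ω A α β) (hb : Bornology.IsBounded Ω) {u v : E d → ℝ}
    {C C' : NNReal} (hu : LipschitzWith C u) (hv : LipschitzWith C' v) :
    IntegrableOn (fun x => matForm (A x) (grad u x) (grad v x)) Ω := by
  have hfin : volume Ω < ⊤ := hb.measure_lt_top
  have hmeas : AEStronglyMeasurable (fun x => matForm (A x) (grad u x) (grad v x))
      (volume.restrict Ω) := by
    refine AEMeasurable.aestronglyMeasurable ?_
    simp only [matForm_apply, Matrix.mulVec, dotProduct]
    refine Finset.aemeasurable_fun_sum _ fun i _ => ?_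
    refine AEMeasurable.mul ?_ (((measurable_pi_apply i).comp (measurable_grad v)).aemeasurable)
    exact Finset.aemeasurable_fun_sum _ fun j _ => (hA.aemeasurable i j).mul
      (((measurable_pi_apply j).comp (measurable_grad u)).aemeasurable)
  have hsq : ∀ {w : E d → ℝ} {c : NNReal}, LipschitzWith c w → ∀ x,
      grad w x ⬝ᵥ grad w x ≤ d * (c : ℝ) ^ 2 := by
    intro w c hw x
    calc grad w x ⬝ᵥ grad w x ≤ ∑ _i : Fin d, (c : ℝ) ^ 2 :=
          Finset.sum_le_sum fun i _ => by
            have := abs_grad_le hw x i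
            rw [← sq, ← sq_abs]
            gcongr
      _ = _ := by simp
  have : IsFiniteMeasure (volume.restrict Ω) := ⟨by simpa using hfin⟩
  refine Integrable.of_bound hmeas (β * (d * (C : ℝ) ^ 2 + d * (C' : ℝ) ^ 2)) ?_
  filter_upwards [hA.symm, hA.bounds] with x hx1 hx2
  have hβ : 0 ≤ β := hA.pos.le.trans hA.le
  refine (abs_matForm_le hx1 (fun g => ?_) (fun g => (hx2 g).2) _ _).trans ?_
  · exact (mul_nonneg hA.pos.le (dotProduct_self_nonneg_real g)).trans (hx2 g).1
  · exact mul_le_mul_of_nonneg_left (add_le_add (hsq hu x) (hsq hv x)) hβ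

theorem ae_restrict (hA : IsElliptic Ω A α β) {D : Set (E d)} (hD : D ⊆ Ω) :
    ∀ᵐ x ∂(volume.restrict D), (A x).IsSymm ∧ ∀ ζ : Fin d → ℝ,
      α * (ζ ⬝ᵥ ζ) ≤ matForm (A x) ζ ζ ∧ matForm (A x) ζ ζ ≤ β * (ζ ⬝ᵥ ζ) :=
  ae_mono (Measure.restrict_mono hD le_rfl) (hA.symm.and hA.bounds)

theorem form_comm (hA : IsElliptic Ω A α β) {D : Set (E d)} (hD : D ⊆ Ω) (u v : E d → ℝ) :
    form A D u v = form A D v u := by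
  refine integral_congr_ae ?_
  filter_upwards [hA.ae_restrict hD] with x hx
  exact matForm_comm hx.1 _ _

theorem form_self_nonneg (hA : IsElliptic Ω A α β) {D : Set (E d)} (hD : D ⊆ Ω) (u : E d → ℝ) :
    0 ≤ form A D u u := by
  refine integral_nonneg_of_ae ?_
  filter_upwards [hA.ae_restrict hD] with x hx
  exact (mul_nonneg hA.pos.le (dotProduct_self_nonneg_real _)).trans (hx.2 _).1

end IsElliptic

theorem form_congr_of_isOpen {d : ℕ} (A : E d → Matrix (Fin d) (Fin d) ℝ) {ω : Set (E d)}
    (hω : IsOpen ω) {u u' v v' : E d → ℝ} (hu : ∀ x ∈ ω, u x = u' x) (hv : ∀ x ∈ ω, v x = v' x) :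
    form A ω u v = form A ω u' v' :=
  setIntegral_congr_fun hω.measurableSet fun x hx => by
    simp only [grad_congr_of_isOpen hω hu hx, grad_congr_of_isOpen hω hv hx]

/-- Off the closure w is locally zero, and the boundary of a resolved set is a null set. -/
theorem Triangulation.Resolves.ae_grad_eq_zero {d : ℕ} {Ω : Set (E d)} {T : Triangulation Ω}
    {ω : Set (E d)} (h : T.Resolves ω) {w : E d → ℝ} (hw : ∀ x, x ∉ closure ω → w x = 0) :
    ∀ᵐ x, x ∉ ω → grad w x = 0 := by
  have h0 : ∀ᵐ x, x ∉ closure ω \ ω := measure_eq_zero_iff_ae_notMem.1 h.volume_frontier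
  filter_upwards [h0] with x hx hxω
  have hx' : x ∉ closure ω := fun hc => hx ⟨hc, hxω⟩
  have : grad w x = grad 0 x :=
    grad_congr_of_isOpen (u := w) (v := 0) isClosed_closure.isOpen_compl
      (fun y hy => hw y hy) hx'
  rw [this]
  funext i
  simp [grad]

theorem Triangulation.Resolves.form_eq {d : ℕ} {Ω : Set (E d)} {T : Triangulation Ω}
    {ω : Set (E d)} (h : T.Resolves ω) (hΩ : IsOpen Ω) (hω : ω ⊆ Ω)
    (A : E d → Matrix (Fin d) (Fin d) ℝ) {w : E d → ℝ} (hw : ∀ x, x ∉ closure ω → w x = 0)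
    (u : E d → ℝ) : form A Ω u w = form A ω u w := by
  refine (setIntegral_eq_of_subset_of_ae_sdiff_eq_zero hΩ.measurableSet.nullMeasurableSet hω ?_)
  filter_upwards [h.ae_grad_eq_zero hw] with x hx hxd
  rw [hx hxd.2, dotProduct_zero]

section FormOnVh

variable {d : ℕ} {Ω : Set (E d)} {A : E d → Matrix (Fin d) (Fin d) ℝ} {α β : ℝ}

/-- `a_D` as a bilinear form on `V_h`. -/
def formBilin (T : Triangulation Ω) (hΩ : IsOpen Ω) (hb : Bornology.IsBounded Ω) {p : ℕ}
    (hp : 1 ≤ p) (hA : IsElliptic Ω A α β) {D : Set (E d)} (hD : D ⊆ Ω) :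
    T.Vh p →ₗ[ℝ] T.Vh p →ₗ[ℝ] ℝ :=
  have hL : ∀ v : T.Vh p, ∃ C, LipschitzWith C (v : E d → ℝ) :=
    fun v => T.exists_lipschitzWith hΩ hb hp v.2
  have hI : ∀ u v : T.Vh p, IntegrableOn
      (fun x => matForm (A x) (grad (u : E d → ℝ) x) (grad (v : E d → ℝ) x)) D := fun u v =>
    (hA.integrableOn hb (hL u).choose_spec (hL v).choose_spec).mono_set hD
  -- Rademacher's theorem: `fderiv` has the default value 0 at points without derivative, so the
  -- gradient is linear in the function only almost everywhere.
  have hdiff : ∀ v : T.Vh p, ∀ᵐ x ∂(volume.restrict D), DifferentiableAt ℝ (v : E d → ℝ) x :=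
    fun v => ae_restrict_of_ae (hL v).choose_spec.ae_differentiableAt
  LinearMap.mk₂ ℝ (fun u v => form A D u v)
    (fun u u' v => by
      refine Eq.trans (integral_congr_ae ?_) (integral_add (hI u v) (hI u' v))
      filter_upwards [hdiff u, hdiff u'] with x h1 h2
      change matForm (A x) (grad ((u : E d → ℝ) + u') x) _ = _
      rw [grad_add h1 h2, map_add, LinearMap.add_apply]
      rfl)
    (fun c u v => by
      refine Eq.trans (integral_congr_ae ?_) (integral_const_mul c _)
      filter_upwards [hdiff u] with x h1
      change matForm (A x) (grad (c • (u : E d → ℝ)) x) _ = _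
      rw [grad_smul c h1, map_smul, LinearMap.smul_apply]
      rfl)
    (fun u v v' => by
      refine Eq.trans (integral_congr_ae ?_) (integral_add (hI u v) (hI u v'))
      filter_upwards [hdiff v, hdiff v'] with x h1 h2
      change matForm (A x) _ (grad ((v : E d → ℝ) + v') x) = _
      rw [grad_add h1 h2, map_add]
      rfl)
    (fun c u v => by
      refine Eq.trans (integral_congr_ae ?_) (integral_const_mul c _)
      filter_upwards [hdiff v] with x h1
      change matForm (A x) _ (grad (c • (v : E d → ℝ)) x) = _
      rw [grad_smul c h1, map_smul]
      rfl)

theorem card_filter_le_overlap {M : ℕ} (ω : Fin M → Set (E d)) {x : E d} (hx : x ∈ Ω)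
    [DecidablePred fun i => x ∈ ω i] :
    (Finset.univ.filter fun i => x ∈ ω i).card ≤ overlap Ω ω := by
  have h1 : {i : Fin M | x ∈ ω i}.ncard = (Finset.univ.filter fun i => x ∈ ω i).card := by
    rw [← Set.ncard_coe_finset]; simp
  rw [← h1]
  refine le_csSup ⟨M, ?_⟩ ⟨x, hx, rfl⟩
  rintro _ ⟨y, -, rfl⟩
  calc _ ≤ (Set.univ : Set (Fin M)).ncard := Set.ncard_le_ncard (Set.subset_univ _)
    _ = M := by simp [Set.ncard_univ]

/-- At almost every point at most `overlap Ω ω` of the gradients are nonzero, so the pointwise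
Cauchy–Schwarz inequality costs only this factor instead of M. -/
theorem form_sum_self_le (T : Triangulation Ω) (hΩ : IsOpen Ω) (hb : Bornology.IsBounded Ω) {p : ℕ}
    (hp : 1 ≤ p) (hA : IsElliptic Ω A α β)
    {M : ℕ} (ω : Fin M → Set (E d)) (hres : ∀ i, T.Resolves (ω i))
    (hω : ∀ i, ω i ⊆ Ω) (f : Fin M → T.Vh p)
    (hf : ∀ i, ∀ x, x ∉ closure (ω i) → (f i : E d → ℝ) x = 0) :
    form A Ω ((∑ i, f i : T.Vh p) : E d → ℝ) ((∑ i, f i : T.Vh p) : E d → ℝ) ≤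
      overlap Ω ω * ∑ i, form A (ω i) (f i) (f i) := by
  classical
  have hL : ∀ v : T.Vh p, ∃ C, LipschitzWith C (v : E d → ℝ) :=
    fun v => T.exists_lipschitzWith hΩ hb hp v.2
  have hI : ∀ v : T.Vh p, IntegrableOn
      (fun x => matForm (A x) (grad (v : E d → ℝ) x) (grad (v : E d → ℝ) x)) Ω := fun v =>
    hA.integrableOn hb (hL v).choose_spec (hL v).choose_spec
  have hdiff : ∀ᵐ x ∂(volume.restrict Ω), ∀ i, DifferentiableAt ℝ (f i : E d → ℝ) x :=
    ae_all_iff.2 fun i => ae_restrict_of_ae (hL (f i)).choose_spec.ae_differentiableAt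
  have hzero : ∀ᵐ x ∂(volume.restrict Ω), ∀ i, x ∉ ω i → grad (f i : E d → ℝ) x = 0 :=
    ae_all_iff.2 fun i => ae_restrict_of_ae ((hres i).ae_grad_eq_zero (hf i))
  have e1 : ∀ i, form A (ω i) (f i) (f i) = ∫ x in Ω, (ω i).indicator
      (fun x => matForm (A x) (grad (f i : E d → ℝ) x) (grad (f i : E d → ℝ) x)) x := by
    intro i
    rw [setIntegral_indicator (hres i).isOpen.measurableSet, Set.inter_eq_self_of_subset_right (hω i)]
    rfl
  have hint : ∀ i, IntegrableOn ((ω i).indicator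
      (fun x => matForm (A x) (grad (f i : E d → ℝ) x) (grad (f i : E d → ℝ) x))) Ω :=
    fun i => (hI (f i)).indicator (hres i).isOpen.measurableSet
  simp only [e1]
  rw [← integral_finsetSum _ (fun i _ => hint i), ← integral_const_mul]
  refine integral_mono_ae (hI _) ((integrable_finsetSum _ fun i _ => hint i).const_mul _) ?_
  filter_upwards [hdiff, hzero, hA.ae_restrict subset_rfl,
    ae_restrict_mem hΩ.measurableSet] with x h1 h2 h3 hxΩ
  change matForm (A x) (grad ((∑ i, f i : T.Vh p) : E d → ℝ) x)
    (grad ((∑ i, f i : T.Vh p) : E d → ℝ) x) ≤ _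
  rw [Submodule.coe_sum, grad_sum _ h1]
  have h0 : ∀ g, 0 ≤ matForm (A x) g g := fun g =>
    (mul_nonneg hA.pos.le (dotProduct_self_nonneg_real g)).trans (h3.2 g).1
  have e2 : ∑ i, grad (f i : E d → ℝ) x =
      ∑ i ∈ Finset.univ.filter (fun i => x ∈ ω i), grad (f i : E d → ℝ) x := by
    refine (Finset.sum_subset (Finset.filter_subset _ _) fun i _ hi => h2 i fun hc => hi ?_).symm
    simpa using hc
  have e3 : ∑ i, (ω i).indicator
      (fun x => matForm (A x) (grad (f i : E d → ℝ) x) (grad (f i : E d → ℝ) x)) x =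
      ∑ i ∈ Finset.univ.filter (fun i => x ∈ ω i),
        matForm (A x) (grad (f i : E d → ℝ) x) (grad (f i : E d → ℝ) x) := by
    rw [Finset.sum_filter]
    exact Finset.sum_congr rfl fun i _ => by simp [Set.indicator_apply]
  rw [e2, e3]
  refine (bilin_sum_self_le _ h0 _ _).trans ?_
  refine mul_le_mul_of_nonneg_right ?_ (Finset.sum_nonneg fun i _ => h0 _)
  exact_mod_cast card_filter_le_overlap ω hxΩ

theorem sum_form_le (T : Triangulation Ω) (hΩ : IsOpen Ω) (hb : Bornology.IsBounded Ω) {p : ℕ}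
    (hp : 1 ≤ p) (hA : IsElliptic Ω A α β)
    {M : ℕ} (ω : Fin M → Set (E d)) (hres : ∀ i, T.Resolves (ω i))
    (hω : ∀ i, ω i ⊆ Ω) (v : T.Vh p) :
    ∑ i, form A (ω i) v v ≤ overlap Ω ω * form A Ω v v := by
  classical
  obtain ⟨C, hC⟩ := T.exists_lipschitzWith hΩ hb hp v.2
  have hI := hA.integrableOn hb hC hC
  have e1 : ∀ i, form A (ω i) v v = ∫ x in Ω, (ω i).indicator
      (fun x => matForm (A x) (grad (v : E d → ℝ) x) (grad (v : E d → ℝ) x)) x := by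
    intro i
    rw [setIntegral_indicator (hres i).isOpen.measurableSet, Set.inter_eq_self_of_subset_right (hω i)]
    rfl
  have hint : ∀ i, IntegrableOn ((ω i).indicator
      (fun x => matForm (A x) (grad (v : E d → ℝ) x) (grad (v : E d → ℝ) x))) Ω :=
    fun i => hI.indicator (hres i).isOpen.measurableSet
  simp only [e1]
  rw [← integral_finsetSum _ (fun i _ => hint i), form, ← integral_const_mul]
  refine integral_mono_ae (integrable_finsetSum _ fun i _ => hint i) (hI.const_mul _) ?_
  filter_upwards [hA.ae_restrict subset_rfl, ae_restrict_mem hΩ.measurableSet] with x h3 hxΩ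
  have h0 : ∀ g, 0 ≤ matForm (A x) g g := fun g =>
    (mul_nonneg hA.pos.le (dotProduct_self_nonneg_real g)).trans (h3.2 g).1
  have e3 : ∑ i, (ω i).indicator
      (fun x => matForm (A x) (grad (v : E d → ℝ) x) (grad (v : E d → ℝ) x)) x =
      (Finset.univ.filter (fun i => x ∈ ω i)).card *
        matForm (A x) (grad (v : E d → ℝ) x) (grad (v : E d → ℝ) x) := by
    rw [← nsmul_eq_mul, ← Finset.sum_const, Finset.sum_filter]
    exact Finset.sum_congr rfl fun i _ => by simp [Set.indicator_apply]
  rw [e3]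
  refine mul_le_mul_of_nonneg_right ?_ (h0 _)
  exact_mod_cast card_filter_le_overlap ω hxΩ

end FormOnVh

/-! ### Truncation of eigenfunction expansions -/

/-- Truncation of an expansion in eigenvectors of the pencil `(b, a)`: the part that belongs to
the eigenvalues at most `μ` has `b`-energy at most `μ` times the `a`-energy of the whole. -/
theorem bilin_truncation_le {V : Type*} [AddCommGroup V] [Module ℝ V] {N : ℕ}
    (a b : V →ₗ[ℝ] V →ₗ[ℝ] ℝ) (ha : ∀ u v, a u v = a v u) (ha0 : ∀ v, 0 ≤ a v v)
    (hb : ∀ u v, b u v = b v u) (φ : Fin N → V) (lam : Fin N → ℝ≥0∞)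
    (htop : ∀ j l, lam j = ⊤ → a (φ j) (φ l) = 0)
    (heig : ∀ j l, lam j ≠ ⊤ → b (φ j) (φ l) = (lam j).toReal * a (φ j) (φ l))
    (μ : ℝ≥0∞) (hμ : μ ≠ ⊤) (c : Fin N → ℝ) :
    b (∑ j ∈ Finset.univ.filter (fun j => lam j ≤ μ), c j • φ j)
        (∑ j ∈ Finset.univ.filter (fun j => lam j ≤ μ), c j • φ j) ≤
      μ.toReal * a (∑ j, c j • φ j) (∑ j, c j • φ j) := by
  -- Eigenvectors to different eigenvalues are a-orthogonal, those to ∞ being orthogonal to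
  -- everything. Nothing is assumed inside one eigenspace.
  have horth : ∀ j l, lam j ≠ lam l → a (φ j) (φ l) = 0 := by
    intro j l hne
    by_cases hj : lam j = ⊤
    · exact htop j l hj
    by_cases hl : lam l = ⊤
    · rw [ha, htop l j hl]
    have h1 := heig j l hj
    have h2 := heig l j hl
    rw [hb, h1, ha (φ l)] at h2
    have h3 : (lam j).toReal ≠ (lam l).toReal := fun h =>
      hne ((ENNReal.toReal_eq_toReal_iff' hj hl).1 h)
    exact (mul_eq_mul_right_iff.1 h2).resolve_left h3
  set s := Finset.univ.filter (fun j => lam j ≤ μ) with hs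
  set R := ∑ j ∈ s, c j • φ j with hR
  set Q := ∑ j ∈ Finset.univ.filter (fun j => ¬ lam j ≤ μ), c j • φ j with hQ
  have hH : ∑ j, c j • φ j = R + Q := (Finset.sum_filter_add_sum_filter_not _ _ _).symm
  have hexp : ∀ (B : V →ₗ[ℝ] V →ₗ[ℝ] ℝ) (t t' : Finset (Fin N)) (c c' : Fin N → ℝ),
      B (∑ j ∈ t, c j • φ j) (∑ l ∈ t', c' l • φ l) =
        ∑ j ∈ t, ∑ l ∈ t', c j * c' l * B (φ j) (φ l) := by
    intro B t t' c c'
    simp only [map_sum, LinearMap.sum_apply, map_smul, LinearMap.smul_apply, smul_eq_mul]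
    rw [Finset.sum_comm]
    refine Finset.sum_congr rfl fun j _ => ?_
    rw [Finset.mul_sum]
    exact Finset.sum_congr rfl fun l _ => by ring
  have hRQ : a R Q = 0 := by
    rw [hR, hQ, hexp]
    refine Finset.sum_eq_zero fun j hj => Finset.sum_eq_zero fun l hl => ?_
    rw [horth j l, mul_zero]
    intro h
    simp only [hs, Finset.mem_filter, Finset.mem_univ, true_and] at hj hl
    exact hl (h ▸ hj)
  have h1 : a R R ≤ a (R + Q) (R + Q) := by
    simp only [map_add, LinearMap.add_apply, ha Q R, hRQ]
    linarith [ha0 Q]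
  have hle : ∀ j ∈ s, (lam j).toReal ≤ μ.toReal := fun j hj =>
    ENNReal.toReal_mono hμ (Finset.mem_filter.1 hj).2
  have hlt : ∀ j ∈ s, lam j ≠ ⊤ := fun j hj =>
    ((Finset.mem_filter.1 hj).2.trans_lt hμ.lt_top).ne
  -- The difference is the a-energy of the vector whose coefficients are scaled by √(μ - λ_j): mixed
  -- terms survive only between equal eigenvalues, where the two roots multiply to μ - λ_j. Hence it
  -- is nonnegative without orthogonalizing the eigenspaces.
  have h2 : μ.toReal * a R R - b R R =
      a (∑ j ∈ s, (c j * √(μ.toReal - (lam j).toReal)) • φ j)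
        (∑ j ∈ s, (c j * √(μ.toReal - (lam j).toReal)) • φ j) := by
    rw [hexp a s s (fun j => c j * √(μ.toReal - (lam j).toReal)), hR, hexp, hexp,
      Finset.mul_sum, ← Finset.sum_sub_distrib]
    refine Finset.sum_congr rfl fun j hj => ?_
    rw [Finset.mul_sum, ← Finset.sum_sub_distrib]
    refine Finset.sum_congr rfl fun l hl => ?_
    rw [heig j l (hlt j hj)]
    by_cases hjl : lam j = lam l
    · have hsq := Real.mul_self_sqrt (sub_nonneg.2 (hle j hj))
      rw [← hjl]
      linear_combination (-(c j * c l * a (φ j) (φ l))) * hsq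
    · rw [horth j l hjl]; ring
  have h3 := ha0 (∑ j ∈ s, (c j * √(μ.toReal - (lam j).toReal)) • φ j)
  rw [← h2] at h3
  rw [hH]
  have h4 := mul_le_mul_of_nonneg_left h1 (ENNReal.toReal_nonneg (a := μ))
  linarith

/-! ### Local approximation and the coarse space -/

section Method

variable {d : ℕ} {Ω : Set (E d)} {T : Triangulation Ω} {p n M : ℕ}

theorem NodalBasis.repr_apply (Ψ : NodalBasis T p n) (v : T.Vh p) (k : Fin n) :
    Ψ.basis.repr v k = (v : E d → ℝ) (Ψ.node k) := by
  have h := congrArg (fun w : T.Vh p => (w : E d → ℝ) (Ψ.node k)) (Ψ.basis.sum_repr v)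
  simp only [Submodule.coe_sum, Finset.sum_apply, Submodule.coe_smul, Pi.smul_apply, smul_eq_mul,
    Ψ.basis_node, mul_ite, mul_one, mul_zero, Finset.sum_ite_eq', Finset.mem_univ, if_true] at h
  exact h

theorem NodalBasis.interp_node (Ψ : NodalBasis T p n) (g : E d → ℝ) (k : Fin n) :
    (Ψ.interp g : E d → ℝ) (Ψ.node k) = g (Ψ.node k) := by
  simp [NodalBasis.interp, Finset.sum_apply, Ψ.basis_node]

theorem NodalBasis.ext (Ψ : NodalBasis T p n) {u v : T.Vh p}
    (h : ∀ k, (u : E d → ℝ) (Ψ.node k) = (v : E d → ℝ) (Ψ.node k)) : u = v :=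
  Ψ.basis.ext_elem fun k => by rw [Ψ.repr_apply, Ψ.repr_apply, h]

theorem restr_restr {ω ω' : Set (E d)} (h : ω ⊆ ω') (v : E d → ℝ) :
    restr ω (restr ω' v) = restr ω v := by
  funext x
  by_cases hx : x ∈ ω
  · simp [restr, hx, h hx]
  · simp [restr, hx]

/-- The support condition only gives the closure of ω_i. By continuity χ_i is nonzero near x, so x
is interior to that closure, and a resolved set equals the interior of its closure. -/
theorem Decomposition.mem_of_ne_zero (D : Decomposition T M) (hΩ : IsOpen Ω) {i : Fin M} {x : E d}
    (hx : x ∈ Ω) (h : D.χ i x ≠ 0) : x ∈ D.ω i := by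
  rw [← (D.resolves i).interior_closure, mem_interior_iff_mem_nhds]
  have h1 := ((D.continuousOn i).continuousAt (hΩ.mem_nhds hx)).eventually_ne h
  filter_upwards [h1, hΩ.mem_nhds hx] with y hy hyΩ
  exact D.supp i y hyΩ hy

/-- The operator `v ↦ χ_{h,i}(v|_{ω_i})` on `V_h`. -/
def localize (Ψ : NodalBasis T p n) (D : Decomposition T M) (i : Fin M) :
    T.Vh p →ₗ[ℝ] T.Vh p :=
  pou Ψ D i ∘ₗ restr (D.ω i) ∘ₗ (T.Vh p).subtype

theorem localize_node (Ψ : NodalBasis T p n) (D : Decomposition T M) (i : Fin M) (v : T.Vh p)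
    (k : Fin n) : (localize Ψ D i v : E d → ℝ) (Ψ.node k) =
      D.χ i (Ψ.node k) * (D.ω i).indicator v (Ψ.node k) :=
  Ψ.interp_node _ k

/-- It suffices to compare nodal values, where this is ∑ χ_i = 1; the cut-off to ω_i is harmless
since χ_i vanishes at nodes outside ω_i. -/
theorem sum_localize (Ψ : NodalBasis T p n) (D : Decomposition T M) (hΩ : IsOpen Ω)
    (v : T.Vh p) : ∑ i, localize Ψ D i v = v := by
  refine Ψ.ext fun k => ?_
  have hk : (Ψ.node k : E d) ∈ Ω := (Ψ.node k).2.1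
  rw [Submodule.coe_sum, Finset.sum_apply]
  simp only [localize_node]
  calc ∑ i, D.χ i (Ψ.node k) * (D.ω i).indicator v (Ψ.node k)
      = ∑ i, D.χ i (Ψ.node k) * (v : E d → ℝ) (Ψ.node k) := by
        refine Finset.sum_congr rfl fun i _ => ?_
        by_cases h : D.χ i (Ψ.node k) = 0
        · rw [h, zero_mul, zero_mul]
        · rw [Set.indicator_of_mem (D.mem_of_ne_zero hΩ hk h)]
    _ = _ := by rw [← Finset.sum_mul, D.sum_eq_one _ hk, one_mul]

theorem localize_eq_zero (Ψ : NodalBasis T p n) (D : Decomposition T M) (hp : 1 ≤ p) (i : Fin M)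
    (v : T.Vh p) {x : E d} (hx : x ∉ closure (D.ω i)) : (localize Ψ D i v : E d → ℝ) x = 0 := by
  refine (D.resolves i).eq_zero hp (localize Ψ D i v).2 (fun y hy hyω => ?_) hx
  obtain ⟨k, hk⟩ := Ψ.node.surjective ⟨y, hy⟩
  have hy' : y = Ψ.node k := by rw [hk]
  subst hy'
  rw [localize_node, Set.indicator_of_notMem hyω, mul_zero]

variable {Ψ : NodalBasis T p n} {A : E d → Matrix (Fin d) (Fin d) ℝ} {D : Decomposition T M}

/-- This permits truncation by eigenvalue instead of by index. Selected eigenfunctions whose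
eigenvalue equals `lamNext` may stay in the remainder without harm. -/
theorem EigenSystem.lt_m_of_lamNext_lt (S : EigenSystem Ψ A D) {i : Fin M} {j : Fin (S.N i)}
    (h : S.lamNext i < S.lam i j) : (j : ℕ) < S.m i := by
  by_contra! hj
  have hm : S.m i < S.N i := hj.trans_lt j.2
  rw [EigenSystem.lamNext, dif_pos hm] at h
  exact absurd (S.antitone i (show (⟨S.m i, hm⟩ : Fin (S.N i)) ≤ j from hj)) (not_le.2 h)

/-- The eigenfunctions are lifted to V_h. The expansion of h then holds only on ω_i^*, which
suffices because `localize` sees nothing outside ω_i. The large eigenvalues give s, the others give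
g. -/
theorem EigenSystem.exists_local_approx (S : EigenSystem Ψ A D) {α β : ℝ} (hΩ : IsOpen Ω)
    (hreg : interior (closure Ω) = Ω) (hb : Bornology.IsBounded Ω) (hp : 1 ≤ p)
    (hA : IsElliptic Ω A α β) (i : Fin M) (hlam : S.lamNext i ≠ ⊤) (h : T.Vh p)
    (hh : restr (D.ωs i) h ∈ harmonic T p A (D.ωs i)) :
    ∃ s ∈ (S.localSpace i).map (pou Ψ D i), ∃ g : T.Vh p, localize Ψ D i h - s = localize Ψ D i g ∧
      form A (D.ω i) (localize Ψ D i g) (localize Ψ D i g) ≤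
        (S.lamNext i).toReal * form A (D.ωs i) h h := by
  have hω : D.ω i ⊆ Ω := (D.resolves i).subset hreg
  have hωs : D.ωs i ⊆ Ω := (D.resolves_s i).subset hreg
  have hopen := (D.resolves i).isOpen
  have hopens := (D.resolves_s i).isOpen
  have hlift : ∀ j, ∃ φ : T.Vh p, restr (D.ωs i) φ = S.φ i j := fun j => by
    obtain ⟨φ, hφ, e⟩ := (S.eigen i j).1.1
    exact ⟨⟨φ, hφ⟩, e⟩
  choose φ hφ using hlift
  have hpou : ∀ v : T.Vh p, pou Ψ D i (restr (D.ω i) (restr (D.ωs i) v)) = localize Ψ D i v :=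
    fun v => by rw [restr_restr (D.subset i)]; rfl
  have hform : ∀ u v : T.Vh p, form A (D.ωs i) (restr (D.ωs i) u) (restr (D.ωs i) v) =
      form A (D.ωs i) u v := fun u v =>
    form_congr_of_isOpen A hopens (fun x hx => Set.indicator_of_mem hx _)
      (fun x hx => Set.indicator_of_mem hx _)
  rw [← S.span_eq i] at hh
  obtain ⟨c, hc⟩ := (Submodule.mem_span_range_iff_exists_fun ℝ).1 hh
  set H : T.Vh p := ∑ j, c j • φ j with hH
  have hHh : restr (D.ωs i) h = restr (D.ωs i) H := by
    rw [← hc, hH, Submodule.coe_sum, map_sum]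
    refine Finset.sum_congr rfl fun j _ => ?_
    rw [Submodule.coe_smul, map_smul, hφ]
  have hX : localize Ψ D i h = localize Ψ D i H := by rw [← hpou, ← hpou, hHh]
  have hhH : form A (D.ωs i) h h = form A (D.ωs i) H H := by rw [← hform, ← hform, hHh]
  set μ := S.lamNext i with hμ
  set g : T.Vh p := ∑ j ∈ Finset.univ.filter (fun j => S.lam i j ≤ μ), c j • φ j with hg
  set t : T.Vh p := ∑ j ∈ Finset.univ.filter (fun j => ¬ S.lam i j ≤ μ), c j • φ j with ht
  have hHgt : H = g + t := (Finset.sum_filter_add_sum_filter_not _ _ _).symm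
  refine ⟨localize Ψ D i t, ?_, g, ?_, ?_⟩
  · rw [ht, map_sum]
    refine Submodule.sum_mem _ fun j hj => ?_
    rw [map_smul]
    refine Submodule.smul_mem _ _ ?_
    have hj' : (j : ℕ) < S.m i := S.lt_m_of_lamNext_lt (by simpa using (Finset.mem_filter.1 hj).2)
    refine ⟨restr (D.ω i) (S.φ i j), Submodule.subset_span ⟨j, hj', rfl⟩, ?_⟩
    rw [← hφ, hpou]
  · rw [hX, hHgt, map_add, add_sub_cancel_right]
  · rw [hhH]
    set a := formBilin T hΩ hb hp hA hωs
    set b := (formBilin T hΩ hb hp hA hω).compl₁₂ (localize Ψ D i) (localize Ψ D i) with hbdef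
    have heig := fun j l => (S.eigen i j).2 (S.φ i l) (S.eigen i l).1
    refine bilin_truncation_le a b (fun u v => hA.form_comm hωs u v)
      (fun v => hA.form_self_nonneg hωs v) (fun u v => hA.form_comm hω _ _) φ (S.lam i)
      (fun j l hj => ?_) (fun j l hj => ?_) μ hlam c
    · have := (heig j l).1 hj
      rwa [← hφ, ← hφ, hform] at this
    · have := (heig j l).2 hj
      rwa [← hφ, ← hφ, hform, hpou, hpou] at this

theorem one_le_overlap {ω : Fin M → Set (E d)} (hcov : Ω ⊆ ⋃ i, ω i) (hne : Ω.Nonempty) :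
    1 ≤ overlap Ω ω := by
  classical
  obtain ⟨x, hx⟩ := hne
  obtain ⟨i, hi⟩ := Set.mem_iUnion.1 (hcov hx)
  refine le_trans ?_ (card_filter_le_overlap ω hx)
  exact Finset.card_pos.2 ⟨i, by simpa using hi⟩

/-- Both overlaps are at least 1 because Ω has a point. This excludes the product 0 · ∞ = 0, so
finiteness of Λ forces finiteness of each λ_{i,m_i+1}. -/
theorem EigenSystem.lam_sq (S : EigenSystem Ψ A D) (hne : Ω.Nonempty) (hLam : S.Lam ≠ ⊤)
    (i : Fin M) : S.lamNext i ≠ ⊤ ∧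
      (overlap Ω D.ω : ℝ) * overlap Ω D.ωs * (S.lamNext i).toReal ≤ S.Lam.toReal ^ 2 := by
  have hξ : 1 ≤ overlap Ω D.ω := one_le_overlap D.cover.ge hne
  have hξs : 1 ≤ overlap Ω D.ωs :=
    one_le_overlap (D.cover.ge.trans (Set.iUnion_mono D.subset)) hne
  have hsq : S.Lam ^ 2 =
      (overlap Ω D.ω : ℝ≥0∞) * (overlap Ω D.ωs : ℝ≥0∞) * ⨆ i, S.lamNext i := by
    rw [EigenSystem.Lam, ← ENNReal.rpow_natCast, ← ENNReal.rpow_mul]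
    norm_num
  have hfin : S.Lam ^ 2 ≠ ⊤ := ENNReal.pow_ne_top hLam
  have hle : (overlap Ω D.ω : ℝ≥0∞) * (overlap Ω D.ωs : ℝ≥0∞) * S.lamNext i ≤ S.Lam ^ 2 := by
    rw [hsq]
    gcongr
    exact le_iSup S.lamNext i
  constructor
  · intro htop
    rw [htop, ENNReal.mul_top] at hle
    · exact hfin (top_le_iff.1 hle)
    · exact mul_ne_zero (by exact_mod_cast (Nat.one_le_iff_ne_zero.1 hξ))
        (by exact_mod_cast (Nat.one_le_iff_ne_zero.1 hξs))
  · have := ENNReal.toReal_mono hfin hle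
    simpa [ENNReal.toReal_mul, ENNReal.toReal_pow] using this

/-- One step of the two-level method reduces the energy norm by the factor `Λ`. -/
theorem EigenSystem.exists_coarse_approx (S : EigenSystem Ψ A D) {α β : ℝ} (hΩ : IsOpen Ω)
    (hreg : interior (closure Ω) = Ω) (hb : Bornology.IsBounded Ω) (hp : 1 ≤ p)
    (hA : IsElliptic Ω A α β) (hLam : S.Lam ≠ ⊤) (v : T.Vh p) (u : Fin M → T.Vh p)
    (hu : ∀ i, u i ∈ T.Vh0 p (D.ωs i))
    (horth : ∀ i, ∀ w ∈ T.Vh0 p (D.ωs i), form A Ω (v - u i : T.Vh p) w = 0) :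
    ∃ s ∈ S.coarseSpace,
      form A Ω (v - ∑ i, localize Ψ D i (u i) - s : T.Vh p)
          (v - ∑ i, localize Ψ D i (u i) - s : T.Vh p) ≤
        S.Lam.toReal ^ 2 * form A Ω v v := by
  rcases Ω.eq_empty_or_nonempty with hE | hne
  · refine ⟨0, Submodule.zero_mem _, ?_⟩
    have : ∀ f g, form A Ω f g = 0 := fun f g => by simp [form, hE]
    rw [this, this, mul_zero]
  have hω : ∀ i, D.ω i ⊆ Ω := fun i => (D.resolves i).subset hreg
  have hωs : ∀ i, D.ωs i ⊆ Ω := fun i => (D.resolves_s i).subset hreg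
  have hloc : ∀ i, ∀ w ∈ T.Vh0 p (D.ωs i), form A (D.ωs i) (v - u i : T.Vh p) w = 0 :=
    fun i w hw => by
      rw [← horth i w hw]
      exact ((D.resolves_s i).form_eq hΩ (hωs i) A hw _).symm
  have hharm : ∀ i, restr (D.ωs i) (v - u i : T.Vh p) ∈ harmonic T p A (D.ωs i) := fun i =>
    ⟨⟨_, (v - u i : T.Vh p).2, rfl⟩, fun w hw => by
      rw [← hloc i w hw]
      exact form_congr_of_isOpen A (D.resolves_s i).isOpen
        (fun x hx => Set.indicator_of_mem hx _) (fun _ _ => rfl)⟩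
  choose s hs g hg hle using fun i => S.exists_local_approx hΩ hreg hb hp hA i
    (S.lam_sq hne hLam i).1 (v - u i) (hharm i)
  -- Pythagoras on ω_i^*: v - u_i is orthogonal to u_i.
  have henergy : ∀ i, form A (D.ωs i) (v - u i : T.Vh p) (v - u i : T.Vh p) ≤
      form A (D.ωs i) v v := by
    intro i
    set a := formBilin T hΩ hb hp hA (hωs i)
    have h1 : a (v - u i) (u i) = 0 := hloc i (u i) (hu i)
    have h2 : a (u i) (v - u i) = 0 := (hA.form_comm (hωs i) _ _).trans h1
    have h3 : 0 ≤ a (u i) (u i) := hA.form_self_nonneg (hωs i) _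
    change a (v - u i) (v - u i) ≤ a v v
    simp only [map_sub, LinearMap.sub_apply] at h1 h2 ⊢
    linarith
  refine ⟨∑ i, s i, Submodule.sum_mem _ fun i _ => ?_, ?_⟩
  · exact Submodule.mem_iSup_of_mem i (hs i)
  -- Since v = ∑ χ_{h,i} v, the error is a sum of local remainders χ_{h,i}(v - u_i) - s_i.
  have hz : v - ∑ i, localize Ψ D i (u i) - ∑ i, s i = ∑ i, localize Ψ D i (g i) := by
    conv_lhs => rw [← sum_localize Ψ D hΩ v]
    rw [← Finset.sum_sub_distrib, ← Finset.sum_sub_distrib]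
    refine Finset.sum_congr rfl fun i _ => ?_
    rw [← hg i, map_sub]
  rw [hz]
  have h1 := form_sum_self_le T hΩ hb hp hA D.ω D.resolves hω (fun i => localize Ψ D i (g i))
    (fun i x hx => localize_eq_zero Ψ D hp i (g i) hx)
  have h2 := sum_form_le T hΩ hb hp hA D.ωs D.resolves_s hωs v
  have hξs : (0 : ℝ) < overlap Ω D.ωs := by
    exact_mod_cast one_le_overlap (D.cover.ge.trans (Set.iUnion_mono D.subset)) hne
  -- The extra factor ξ^* completes ξ ξ^* λ ≤ Λ² in every summand; it is recovered on the right when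
  -- the local energies of v are summed over the ω_i^*.
  refine h1.trans (le_of_mul_le_mul_left ?_ hξs)
  calc (overlap Ω D.ωs : ℝ) * (overlap Ω D.ω *
        ∑ i, form A (D.ω i) (localize Ψ D i (g i)) (localize Ψ D i (g i)))
      = ∑ i, (overlap Ω D.ωs : ℝ) * overlap Ω D.ω *
          form A (D.ω i) (localize Ψ D i (g i)) (localize Ψ D i (g i)) := by
        rw [← mul_assoc, Finset.mul_sum]
    _ ≤ ∑ i, S.Lam.toReal ^ 2 * form A (D.ωs i) v v := by
        refine Finset.sum_le_sum fun i _ => ?_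
        have h0 : 0 ≤ form A (D.ωs i) v v := hA.form_self_nonneg (hωs i) _
        calc _ ≤ (overlap Ω D.ωs : ℝ) * overlap Ω D.ω *
              ((S.lamNext i).toReal * form A (D.ωs i) v v) := by
              refine mul_le_mul_of_nonneg_left ?_ (by positivity)
              exact (hle i).trans (mul_le_mul_of_nonneg_left (henergy i) ENNReal.toReal_nonneg)
          _ = (overlap Ω D.ω : ℝ) * overlap Ω D.ωs * (S.lamNext i).toReal *
              form A (D.ωs i) v v := by ring
          _ ≤ _ := mul_le_mul_of_nonneg_right (S.lam_sq hne hLam i).2 h0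
    _ ≤ S.Lam.toReal ^ 2 * (overlap Ω D.ωs * form A Ω v v) := by
        rw [← Finset.mul_sum]
        exact mul_le_mul_of_nonneg_left h2 (sq_nonneg _)
    _ = _ := by ring

end Method

/-! ### Spectral bounds of the stiffness matrix -/

section SpectralBounds

variable {d : ℕ}

/-- Friedrichs' inequality for compactly supported Lipschitz functions. -/
theorem integral_sq_le_integral_grad_sq {v : E d → ℝ} {C : NNReal} (hv : LipschitzWith C v)
    (hs : HasCompactSupport v) {R : ℝ} (hR : 0 < R) (hv0 : ∀ x, R < ‖x‖ → v x = 0) (i : Fin d) :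
    ∫ x, v x ^ 2 ≤ 4 * R ^ 2 * ∫ x, grad v x i ^ 2 := by
  obtain ⟨B, hB⟩ := hs.exists_bound_of_continuous hv.continuous
  have hB0 : 0 ≤ B := (norm_nonneg _).trans (hB 0)
  have hcoord : ∀ x : E d, |x i| ≤ ‖x‖ := fun x => by
    simpa using PiLp.norm_apply_le x i
  -- The factor x i is unbounded, but v vanishes for ‖x‖ > R, so one of the two points can be taken
  -- in the ball.
  have hg : LipschitzWith ⟨R * C + B, by positivity⟩ (fun x : E d => x i * v x) := by
    refine LipschitzWith.of_dist_le_mul fun x y => ?_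
    change _ ≤ (R * C + B) * dist x y
    have key : ∀ x y : E d, ‖x‖ ≤ R → |x i * v x - y i * v y| ≤ (R * C + B) * dist x y := by
      intro x y hx
      have e : x i * v x - y i * v y = x i * (v x - v y) + (x - y) i * v y := by
        simp; ring
      rw [e]
      refine (abs_add_le _ _).trans ?_
      rw [abs_mul, abs_mul, add_mul]
      have h1 : |v x - v y| ≤ C * dist x y := by simpa [Real.dist_eq] using hv.dist_le_mul x y
      have h2 : |(x - y) i| ≤ dist x y := by rw [dist_eq_norm]; exact hcoord _
      have h3 : |v y| ≤ B := hB y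
      have h4 : |x i| ≤ R := (hcoord x).trans hx
      refine add_le_add ?_ ?_
      · rw [mul_assoc]
        exact mul_le_mul h4 h1 (abs_nonneg _) hR.le
      · rw [mul_comm B]
        exact mul_le_mul h2 h3 (abs_nonneg _) dist_nonneg
    rw [Real.dist_eq]
    rcases le_or_gt ‖x‖ R with hx | hx
    · exact key x y hx
    rcases le_or_gt ‖y‖ R with hy | hy
    · rw [abs_sub_comm, dist_comm]
      exact key y x hy
    · rw [hv0 x hx, hv0 y hy]
      simp only [mul_zero, sub_zero, abs_zero]
      positivity
  have hgs : HasCompactSupport (fun x : E d => x i * v x) := hs.mul_left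
  -- Integration by parts of v against x_i v yields ∫ (v² + 2 x_i v ∂_i v) = 0.
  have hparts := hv.integral_lineDeriv_mul_eq (μ := volume) hg hgs (EuclideanSpace.single i (1 : ℝ))
  have e1 : ∫ x, lineDeriv ℝ v x (EuclideanSpace.single i (1 : ℝ)) * (x i * v x) =
      ∫ x, x i * v x * grad v x i := by
    refine integral_congr_ae ?_
    filter_upwards [hv.ae_differentiableAt] with x hx
    rw [hx.lineDeriv_eq_fderiv, grad]; ring
  have e2 : ∫ x, lineDeriv ℝ (fun x : E d => x i * v x) x (-EuclideanSpace.single i (1 : ℝ)) * v x =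
      ∫ x, -(v x ^ 2 + x i * v x * grad v x i) := by
    refine integral_congr_ae ?_
    filter_upwards [hv.ae_differentiableAt] with x hx
    have hc : HasFDerivAt (fun x : E d => x i) (EuclideanSpace.proj (𝕜 := ℝ) i) x :=
      (EuclideanSpace.proj (𝕜 := ℝ) i).hasFDerivAt
    have hd := hc.mul hx.hasFDerivAt
    have hl : lineDeriv ℝ (fun x : E d => x i * v x) x (-EuclideanSpace.single i (1 : ℝ)) = _ :=
      (hd.hasLineDerivAt (-EuclideanSpace.single i (1 : ℝ))).lineDeriv
    rw [hl]
    simp [grad]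
    ring
  have hgm : Measurable fun x => grad v x i := (measurable_pi_apply i).comp (measurable_grad v)
  have hgz : ∀ x, x ∉ tsupport v → grad v x i = 0 := fun x hx => by
    simp [grad, fderiv_of_notMem_tsupport ℝ hx]
  have hint : ∀ f : E d → ℝ, Measurable f → (∃ b, ∀ x, |f x| ≤ b) → (∀ x, x ∉ tsupport v → f x = 0) →
      Integrable f := by
    rintro f hf ⟨b, hb⟩ hz
    have : IsFiniteMeasure (volume.restrict (tsupport v)) :=
      ⟨by simpa using hs.isCompact.measure_lt_top⟩
    have h1 : IntegrableOn f (tsupport v) :=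
      Integrable.of_bound hf.aestronglyMeasurable b (ae_of_all _ hb)
    exact (integrableOn_iff_integrable_of_support_subset
      (fun x hx => by_contra fun h => hx (hz x h))).1 h1
  have hvm : Measurable v := hv.continuous.measurable
  have hvz : ∀ x, x ∉ tsupport v → v x = 0 := fun x hx => image_eq_zero_of_notMem_tsupport hx
  have i1 : Integrable fun x => v x ^ 2 := hint _ (hvm.pow_const 2)
    ⟨B ^ 2, fun x => by
      rw [abs_pow]; exact pow_le_pow_left₀ (abs_nonneg _) (hB x) 2⟩
    (fun x hx => by simp [hvz x hx])
  have i2 : Integrable fun x => grad v x i ^ 2 := hint _ (hgm.pow_const 2)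
    ⟨(C : ℝ) ^ 2, fun x => by
      rw [abs_pow]; exact pow_le_pow_left₀ (abs_nonneg _) (abs_grad_le hv x i) 2⟩
    (fun x hx => by simp [hgz x hx])
  have hxv : ∀ x : E d, |x i * v x| ≤ R * B := fun x => by
    rcases le_or_gt ‖x‖ R with hx | hx
    · rw [abs_mul]
      exact mul_le_mul ((hcoord x).trans hx) (hB x) (abs_nonneg _) hR.le
    · rw [hv0 x hx]; simp; positivity
  have i3 : Integrable fun x : E d => x i * v x * grad v x i := hint _
    ((hg.continuous.measurable).mul hgm)
    ⟨R * B * C, fun x => by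
      rw [abs_mul]
      exact mul_le_mul (hxv x) (abs_grad_le hv x i) (abs_nonneg _) (by positivity)⟩
    (fun x hx => by simp [hvz x hx])
  rw [e1, e2, integral_neg, integral_add i1 i3] at hparts
  -- The right side has integral zero. The pointwise inequality is (v + 2 x_i ∂_i v)² ≥ 0 combined
  -- with |x_i| ≤ R.
  have h5 : ∫ x, (v x ^ 2 / 2 - 2 * R ^ 2 * grad v x i ^ 2) ≤
      ∫ x, (v x ^ 2 + 2 * (x i * v x * grad v x i)) := by
    refine integral_mono ((i1.div_const 2).sub (i2.const_mul _)) (i1.add (i3.const_mul 2))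
      fun x => ?_
    rcases le_or_gt ‖x‖ R with hx | hx
    · have h6 : (x i) ^ 2 ≤ R ^ 2 := by
        rw [← sq_abs]; exact pow_le_pow_left₀ (abs_nonneg _) ((hcoord x).trans hx) 2
      have h7 := mul_le_mul_of_nonneg_right h6 (sq_nonneg (grad v x i))
      have h8 := sq_nonneg (v x + 2 * (x i * grad v x i))
      change v x ^ 2 / 2 - 2 * R ^ 2 * grad v x i ^ 2 ≤ v x ^ 2 + 2 * (x i * v x * grad v x i)
      nlinarith
    · have := sq_nonneg (R * grad v x i)
      change v x ^ 2 / 2 - 2 * R ^ 2 * grad v x i ^ 2 ≤ v x ^ 2 + 2 * (x i * v x * grad v x i)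
      rw [hv0 x hx]
      nlinarith
  rw [integral_sub (i1.div_const 2) (i2.const_mul _), integral_add i1 (i3.const_mul 2),
    integral_const_mul, integral_const_mul, integral_div] at h5
  linarith

theorem Triangulation.resolves_self {Ω : Set (E d)} (T : Triangulation Ω)
    (hreg : interior (closure Ω) = Ω) : T.Resolves Ω :=
  ⟨T.cells, subset_rfl, by rw [T.cover, hreg]⟩

theorem IsElliptic.grad_sq_le_form {Ω : Set (E d)} {A : E d → Matrix (Fin d) (Fin d) ℝ} {α β : ℝ}
    (hA : IsElliptic Ω A α β) (T : Triangulation Ω) (hΩ : IsOpen Ω)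
    (hreg : interior (closure Ω) = Ω) (hb : Bornology.IsBounded Ω) {p : ℕ} (hp : 1 ≤ p)
    (v : T.Vh p) (i : Fin d) :
    α * ∫ x, grad (v : E d → ℝ) x i ^ 2 ≤ form A Ω v v := by
  obtain ⟨C, hC⟩ := T.exists_lipschitzWith hΩ hb hp v.2
  have hz := (T.resolves_self hreg).ae_grad_eq_zero (w := v)
    (fun x hx => v.2.2.1 x fun h => hx (subset_closure h))
  have e : ∫ x, grad (v : E d → ℝ) x i ^ 2 = ∫ x in Ω, grad (v : E d → ℝ) x i ^ 2 := by
    rw [← integral_indicator hΩ.measurableSet]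
    refine integral_congr_ae ?_
    filter_upwards [hz] with x hx
    by_cases h : x ∈ Ω
    · rw [Set.indicator_of_mem h]
    · rw [Set.indicator_of_notMem h, hx h]; simp
  have hfin : IsFiniteMeasure (volume.restrict Ω) := ⟨by simpa using hb.measure_lt_top⟩
  have hgm : Measurable fun x => grad (v : E d → ℝ) x i :=
    (measurable_pi_apply i).comp (measurable_grad (v : E d → ℝ))
  have hint : IntegrableOn (fun x => grad (v : E d → ℝ) x i ^ 2) Ω :=
    Integrable.of_bound (hgm.pow_const 2).aestronglyMeasurable ((C : ℝ) ^ 2) (ae_of_all _ fun x => by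
      rw [Real.norm_eq_abs, abs_pow]
      exact pow_le_pow_left₀ (abs_nonneg _) (abs_grad_le hC x i) 2)
  rw [e, ← integral_const_mul]
  refine integral_mono_ae (hint.const_mul α) (hA.integrableOn hb hC hC) ?_
  filter_upwards [hA.ae_restrict subset_rfl] with x hx
  refine le_trans ?_ (hx.2 _).1
  refine mul_le_mul_of_nonneg_left ?_ hA.pos.le
  rw [sq]
  exact Finset.single_le_sum (f := fun j => grad (v : E d → ℝ) x j * grad (v : E d → ℝ) x j)
    (fun j _ => mul_self_nonneg _) (Finset.mem_univ i)

theorem IsElliptic.form_le_of_lipschitzWith {Ω : Set (E d)}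
    {A : E d → Matrix (Fin d) (Fin d) ℝ} {α β : ℝ} (hA : IsElliptic Ω A α β)
    (hb : Bornology.IsBounded Ω) {v : E d → ℝ} {C : NNReal} (hv : LipschitzWith C v) :
    form A Ω v v ≤ β * (d * (C : ℝ) ^ 2) * volume.real Ω := by
  have hfin : IsFiniteMeasure (volume.restrict Ω) := ⟨by simpa using hb.measure_lt_top⟩
  have h : form A Ω v v ≤ ∫ _ in Ω, β * (d * (C : ℝ) ^ 2) := by
    refine integral_mono_ae (hA.integrableOn hb hv hv) (integrable_const _) ?_
    filter_upwards [hA.ae_restrict subset_rfl] with x hx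
    refine (hx.2 _).2.trans (mul_le_mul_of_nonneg_left ?_ (hA.pos.le.trans hA.le))
    calc grad v x ⬝ᵥ grad v x ≤ ∑ _i : Fin d, (C : ℝ) ^ 2 :=
          Finset.sum_le_sum fun i _ => by
            have := abs_grad_le hv x i
            rw [← sq, ← sq_abs]
            gcongr
      _ = _ := by simp
  refine h.trans (le_of_eq ?_)
  rw [setIntegral_const, smul_eq_mul, mul_comm]

theorem eucl_sq {n : ℕ} (x : Fin n → ℝ) : eucl x ^ 2 = ∑ k, x k ^ 2 := by
  rw [eucl, EuclideanSpace.norm_sq_eq]; simp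

variable {Ω : Set (E d)} {T : Triangulation Ω} {p n : ℕ}

/-- The nodes are separated, and so their number is bounded. -/
theorem NodalBasis.card_le (Ψ : NodalBasis T p n) (hΩ : IsOpen Ω) (hp : 1 ≤ p) {r R : ℝ}
    (hr : 0 < r) (hrR : r ≤ R) (hball : ∀ K ∈ T.cells, ∃ c, Metric.closedBall c r ⊆ cell K)
    (hR : Ω ⊆ Metric.closedBall 0 R) :
    (n : ℝ) * (r / (2 * inverseConst d p)) ^ d ≤ (2 * R) ^ d := by
  have hc := one_le_inverseConst d hp
  have hc0 := inverseConst_pos d hp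
  set ρ := r / (2 * inverseConst d p) with hρ
  have hρ0 : 0 < ρ := by positivity
  have hρR : ρ ≤ R := (div_le_self hr.le (by linarith)).trans hrR
  -- The basis function ψ_k drops from 1 to 0 between the two nodes, and the inverse estimate with B
  -- = 1 limits its slope to `inverseConst d p / r`.
  have hsep : ∀ k l, k ≠ l → 2 * ρ ≤ dist (Ψ.node k : E d) (Ψ.node l) := by
    intro k l hkl
    have h := T.dist_le_of_mem_Vh hΩ hp (Ψ.basis k).2 hr hball 1 zero_le_one
      (fun x hx => by
        obtain ⟨j, hj⟩ := Ψ.node.surjective ⟨x, hx⟩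
        have hx' : x = Ψ.node j := by rw [hj]
        rw [hx', Ψ.basis_node]
        split_ifs <;> simp) (Ψ.node k) (Ψ.node l)
    rw [Ψ.basis_node, Ψ.basis_node, if_pos rfl, if_neg hkl, sub_zero, abs_one, mul_one,
      div_mul_eq_mul_div, le_div_iff₀ hr] at h
    rw [hρ]
    have : 2 * (r / (2 * inverseConst d p)) = r / inverseConst d p := by field_simp
    rw [this, div_le_iff₀ hc0]
    linarith
  have hκ : 0 < volume.real (Metric.ball (0 : E d) 1) :=
    ENNReal.toReal_pos (Metric.measure_ball_pos _ _ one_pos).ne' Metric.isBounded_ball.measure_lt_top.ne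
  have hvol : ∀ (x : E d) {s : ℝ}, 0 < s →
      volume.real (Metric.ball x s) = s ^ d * volume.real (Metric.ball (0 : E d) 1) := by
    intro x s hs
    rw [measureReal_def, Measure.addHaar_ball_of_pos volume x hs, ENNReal.toReal_mul,
      ENNReal.toReal_ofReal (by positivity), measureReal_def, finrank_euclideanSpace_fin]
  have hsum : ∑ k : Fin n, volume.real (Metric.ball (Ψ.node k : E d) ρ) ≤
      volume.real (Metric.ball (0 : E d) (2 * R)) := by
    rw [← measureReal_biUnion_finset]
    · refine measureReal_mono ?_ Metric.isBounded_ball.measure_lt_top.ne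
      refine Set.iUnion₂_subset fun k _ => Metric.ball_subset_ball' ?_
      have := hR (Ψ.node k).2.1
      rw [Metric.mem_closedBall] at this
      linarith
    · intro k _ l _ hkl
      refine Metric.ball_disjoint_ball ?_
      have := hsep k l hkl
      linarith
    · exact fun _ _ => measurableSet_ball
  rw [hvol _ (by linarith)] at hsum
  simp only [hvol _ hρ0, Finset.sum_const, Finset.card_univ, Fintype.card_fin, nsmul_eq_mul,
    ← mul_assoc] at hsum
  exact le_of_mul_le_mul_right hsum hκ

theorem IsElliptic.form_le_eucl_sq {A : E d → Matrix (Fin d) (Fin d) ℝ} {α β : ℝ}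
    (hA : IsElliptic Ω A α β) (Ψ : NodalBasis T p n) (hΩ : IsOpen Ω) (hb : Bornology.IsBounded Ω)
    (hp : 1 ≤ p) {r : ℝ} (hr : 0 < r)
    (hball : ∀ K ∈ T.cells, ∃ c, Metric.closedBall c r ⊆ cell K) (v : T.Vh p) :
    form A Ω v v ≤ β * (d * (inverseConst d p / r) ^ 2) * volume.real Ω *
      eucl (fun k => (v : E d → ℝ) (Ψ.node k)) ^ 2 := by
  have hc0 := inverseConst_pos d hp
  have hβ : 0 ≤ β := hA.pos.le.trans hA.le
  set N := eucl (fun k => (v : E d → ℝ) (Ψ.node k)) with hN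
  have hN0 : 0 ≤ N := norm_nonneg _
  have hnode : ∀ x ∈ T.interiorNodes p, |(v : E d → ℝ) x| ≤ N := by
    intro x hx
    obtain ⟨j, hj⟩ := Ψ.node.surjective ⟨x, hx⟩
    have hx' : x = Ψ.node j := by rw [hj]
    rw [hx']
    refine abs_le_of_sq_le_sq ?_ hN0
    rw [hN, eucl_sq]
    exact Finset.single_le_sum (f := fun k => (v : E d → ℝ) (Ψ.node k) ^ 2)
      (fun _ _ => sq_nonneg _) (Finset.mem_univ j)
  have hL : LipschitzWith ⟨inverseConst d p * N / r, by positivity⟩ (v : E d → ℝ) :=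
    LipschitzWith.of_dist_le_mul fun x y =>
      T.dist_le_of_mem_Vh hΩ hp v.2 hr hball N hN0 hnode x y
  refine (hA.form_le_of_lipschitzWith hb hL).trans (le_of_eq ?_)
  change β * (d * (inverseConst d p * N / r) ^ 2) * volume.real Ω = _
  ring

/-- Let B be the largest nodal value in modulus. By the inverse estimate |v| ≥ B / 2 on a ball of
radius ρ = r / (2c), with c = `inverseConst d p`, around its node, which bounds ∫ v² below;
Friedrichs' inequality passes to the energy. The Euclidean norm squared is at most n B². One factor
ρ^d comes from the volume of the ball, the other from the bound on n. -/
theorem IsElliptic.eucl_sq_le_form {A : E d → Matrix (Fin d) (Fin d) ℝ} {α β : ℝ}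
    (hA : IsElliptic Ω A α β) (Ψ : NodalBasis T p n) (hd : 0 < d) (hΩ : IsOpen Ω)
    (hreg : interior (closure Ω) = Ω) (hb : Bornology.IsBounded Ω) (hp : 1 ≤ p) {r R : ℝ}
    (hr : 0 < r) (hrR : r ≤ R) (hball : ∀ K ∈ T.cells, ∃ c, Metric.closedBall c r ⊆ cell K)
    (hR : Ω ⊆ Metric.closedBall 0 R) (v : T.Vh p) :
    α * volume.real (Metric.ball (0 : E d) 1) * ((r / (2 * inverseConst d p)) ^ d) ^ 2 /
        (16 * R ^ 2 * (2 * R) ^ d) * eucl (fun k => (v : E d → ℝ) (Ψ.node k)) ^ 2 ≤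
      form A Ω v v := by
  have hc0 := inverseConst_pos d hp
  have hR0 : 0 < R := hr.trans_le hrR
  rcases Nat.eq_zero_or_pos n with hn | hn
  · subst hn
    have : eucl (fun k => (v : E d → ℝ) (Ψ.node k)) ^ 2 = 0 := by rw [eucl_sq]; simp
    rw [this, mul_zero]
    exact hA.form_self_nonneg subset_rfl _
  have hne : Nonempty (Fin n) := ⟨⟨0, hn⟩⟩
  obtain ⟨k, hk⟩ := Finite.exists_max fun k => |(v : E d → ℝ) (Ψ.node k)|
  set B := |(v : E d → ℝ) (Ψ.node k)| with hB
  have hB0 : 0 ≤ B := abs_nonneg _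
  set ρ := r / (2 * inverseConst d p) with hρ
  have hρ0 : 0 < ρ := by positivity
  set κ := volume.real (Metric.ball (0 : E d) 1) with hκ
  have hκ0 : 0 ≤ κ := measureReal_nonneg
  have hlip := T.dist_le_of_mem_Vh hΩ hp v.2 hr hball B hB0 (fun x hx => by
    obtain ⟨j, hj⟩ := Ψ.node.surjective ⟨x, hx⟩
    have hx' : x = Ψ.node j := by rw [hj]
    rw [hx']; exact hk j)
  have hlow : ∀ y ∈ Metric.closedBall (Ψ.node k : E d) ρ, (B / 2) ^ 2 ≤ (v : E d → ℝ) y ^ 2 := by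
    intro y hy
    rw [← sq_abs ((v : E d → ℝ) y)]
    refine pow_le_pow_left₀ (by positivity) ?_ 2
    have h1 := hlip (Ψ.node k) y
    have h2 : inverseConst d p * B / r * dist (Ψ.node k : E d) y ≤ B / 2 := by
      rw [dist_comm]
      calc _ ≤ inverseConst d p * B / r * ρ :=
            mul_le_mul_of_nonneg_left (Metric.mem_closedBall.1 hy) (by positivity)
        _ = B / 2 := by rw [hρ]; field_simp
    have h3 := abs_sub_abs_le_abs_sub ((v : E d → ℝ) (Ψ.node k)) ((v : E d → ℝ) y)
    linarith
  obtain ⟨C, hC⟩ := T.exists_lipschitzWith hΩ hb hp v.2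
  have hcs := T.hasCompactSupport_of_mem_Vh hb v.2
  have hint : Integrable fun x => (v : E d → ℝ) x ^ 2 := by
    have hs2 : HasCompactSupport fun x => (v : E d → ℝ) x * (v : E d → ℝ) x := hcs.mul_left
    simp only [sq]
    exact (hC.continuous.mul hC.continuous).integrable_of_hasCompactSupport hs2
  have hmass : ρ ^ d * κ * (B / 2) ^ 2 ≤ ∫ x, (v : E d → ℝ) x ^ 2 := by
    refine le_trans ?_ (setIntegral_le_integral (s := Metric.closedBall (Ψ.node k : E d) ρ) hint
      (ae_of_all _ fun x => sq_nonneg _))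
    have h1 : ∫ _ in Metric.closedBall (Ψ.node k : E d) ρ, (B / 2) ^ 2 = ρ ^ d * κ * (B / 2) ^ 2 := by
      rw [setIntegral_const, smul_eq_mul,
        Measure.addHaar_real_closedBall (volume : Measure (E d)) _ hρ0.le,
        finrank_euclideanSpace_fin]
    rw [← h1]
    refine setIntegral_mono_on (integrableOn_const Metric.isBounded_closedBall.measure_lt_top.ne)
      hint.integrableOn measurableSet_closedBall hlow
  have hfried := integral_sq_le_integral_grad_sq hC hcs hR0
    (fun x hx => v.2.2.1 x fun h => by
      have := hR h
      rw [mem_closedBall_zero_iff] at this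
      linarith) ⟨0, hd⟩
  have hgrad := hA.grad_sq_le_form T hΩ hreg hb hp v ⟨0, hd⟩
  have hcard := Ψ.card_le hΩ hp hr hrR hball hR
  have heucl : eucl (fun k => (v : E d → ℝ) (Ψ.node k)) ^ 2 ≤ n * B ^ 2 := by
    rw [eucl_sq]
    calc ∑ k, (v : E d → ℝ) (Ψ.node k) ^ 2 ≤ ∑ _k : Fin n, B ^ 2 :=
          Finset.sum_le_sum fun j _ => by
            rw [← sq_abs]; exact pow_le_pow_left₀ (abs_nonneg _) (hk j) 2
      _ = _ := by simp
  have hα := hA.pos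
  rw [div_mul_eq_mul_div, div_le_iff₀ (by positivity)]
  calc α * κ * (ρ ^ d) ^ 2 * eucl (fun k => (v : E d → ℝ) (Ψ.node k)) ^ 2
      ≤ α * κ * (ρ ^ d) ^ 2 * (n * B ^ 2) := by gcongr
    _ = α * (4 * (ρ ^ d * κ * (B / 2) ^ 2)) * (n * ρ ^ d) := by ring
    _ ≤ α * (4 * (4 * R ^ 2 * ∫ x, grad (v : E d → ℝ) x ⟨0, hd⟩ ^ 2)) * (2 * R) ^ d := by
        refine mul_le_mul (mul_le_mul_of_nonneg_left ?_ hα.le) hcard (by positivity) ?_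
        · linarith [hmass.trans hfried]
        · have : 0 ≤ ∫ x, grad (v : E d → ℝ) x ⟨0, hd⟩ ^ 2 := integral_nonneg fun x => sq_nonneg _
          positivity
    _ = (α * ∫ x, grad (v : E d → ℝ) x ⟨0, hd⟩ ^ 2) * (16 * R ^ 2 * (2 * R) ^ d) := by ring
    _ ≤ _ := by gcongr

end SpectralBounds

/-! ### From matrices to operators on V_h -/

section MatrixForm

variable {d : ℕ} {Ω : Set (E d)} {T : Triangulation Ω} {p n M : ℕ}

theorem form_eq_dotProduct_stiffness (Ψ : NodalBasis T p n) {A : E d → Matrix (Fin d) (Fin d) ℝ}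
    {α β : ℝ} (hA : IsElliptic Ω A α β) (hΩ : IsOpen Ω) (hb : Bornology.IsBounded Ω) (hp : 1 ≤ p)
    (u v : T.Vh p) :
    form A Ω u v = Ψ.basis.repr u ⬝ᵥ (stiffness Ψ A *ᵥ Ψ.basis.repr v) := by
  set a := formBilin T hΩ hb hp hA subset_rfl
  change a u v = _
  conv_lhs => rw [← Ψ.basis.sum_repr u, ← Ψ.basis.sum_repr v]
  simp only [map_sum, LinearMap.sum_apply, map_smul, LinearMap.smul_apply, smul_eq_mul, dotProduct,
    Matrix.mulVec, Finset.mul_sum]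
  rw [Finset.sum_comm]
  refine Finset.sum_congr rfl fun i _ => Finset.sum_congr rfl fun j _ => ?_
  change _ * (_ * form A Ω (Ψ.basis i) (Ψ.basis j)) = _ * (form A Ω (Ψ.basis i) (Ψ.basis j) * _)
  ring

theorem extMatrix_mulVec (Ψ : NodalBasis T p n) {W : Submodule ℝ (T.Vh p)} {r : ℕ}
    (w : Module.Basis (Fin r) ℝ W) (u : W) :
    extMatrix Ψ w *ᵥ w.repr u = Ψ.basis.repr (u : T.Vh p) :=
  LinearMap.toMatrix_mulVec_repr w Ψ.basis W.subtype u

theorem pouMatrix_mulVec (Ψ : NodalBasis T p n) (D : Decomposition T M) (i : Fin M) {r : ℕ}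
    (w : Module.Basis (Fin r) ℝ (T.Vh0 p (D.ωs i))) (u : T.Vh0 p (D.ωs i)) :
    pouMatrix Ψ D i w *ᵥ w.repr u = Ψ.basis.repr (localize Ψ D i (u : T.Vh p)) :=
  LinearMap.toMatrix_mulVec_repr w Ψ.basis _ u

/-- The Galerkin projection onto a subspace in matrix form. -/
theorem exists_galerkin (Ψ : NodalBasis T p n) {A : E d → Matrix (Fin d) (Fin d) ℝ}
    {α β : ℝ} (hA : IsElliptic Ω A α β) (hΩ : IsOpen Ω) (hb : Bornology.IsBounded Ω) (hp : 1 ≤ p)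
    (hpos : ∀ v : T.Vh p, form A Ω v v = 0 → v = 0) {W : Submodule ℝ (T.Vh p)} {r : ℕ}
    (w : Module.Basis (Fin r) ℝ W) (v : T.Vh p) :
    ∃ u : W, w.repr u = ((extMatrix Ψ w)ᵀ * stiffness Ψ A * extMatrix Ψ w)⁻¹ *ᵥ
        ((extMatrix Ψ w)ᵀ *ᵥ (stiffness Ψ A *ᵥ Ψ.basis.repr v)) ∧
      ∀ t ∈ W, form A Ω (v - u : T.Vh p) t = 0 := by
  set R := extMatrix Ψ w with hR
  set K := stiffness Ψ A with hK
  have hmul : ∀ y, R *ᵥ y = Ψ.basis.repr ((w.equivFun.symm y : W) : T.Vh p) := fun y => by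
    rw [← extMatrix_mulVec Ψ w, ← Module.Basis.equivFun_apply, LinearEquiv.apply_symm_apply]
  -- A kernel vector would represent an element of W with zero energy.
  have hdet : IsUnit (Rᵀ * K * R).det := by
    rw [isUnit_iff_ne_zero]
    intro h0
    obtain ⟨y, hy, hy0⟩ := Matrix.exists_mulVec_eq_zero_iff.2 h0
    have h1 : form A Ω ((w.equivFun.symm y : W) : T.Vh p) ((w.equivFun.symm y : W) : T.Vh p) = 0 := by
      rw [form_eq_dotProduct_stiffness Ψ hA hΩ hb hp, ← hmul, Matrix.mulVec_mulVec,
        ← Matrix.vecMul_transpose, ← Matrix.dotProduct_mulVec, Matrix.mulVec_mulVec,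
        ← Matrix.mul_assoc, hy0, dotProduct_zero]
    have h2 := hpos _ h1
    exact hy (w.equivFun.symm.map_eq_zero_iff.1 (Subtype.ext h2))
  set y := (Rᵀ * K * R)⁻¹ *ᵥ (Rᵀ *ᵥ (K *ᵥ Ψ.basis.repr v)) with hy
  have hsolve : Rᵀ *ᵥ (K *ᵥ (R *ᵥ y)) = Rᵀ *ᵥ (K *ᵥ Ψ.basis.repr v) := by
    rw [Matrix.mulVec_mulVec, Matrix.mulVec_mulVec, hy, Matrix.mulVec_mulVec,
      Matrix.mul_nonsing_inv _ hdet, Matrix.one_mulVec]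
  refine ⟨w.equivFun.symm y, ?_, fun t ht => ?_⟩
  · rw [← Module.Basis.equivFun_apply, LinearEquiv.apply_symm_apply]
  · rw [hA.form_comm subset_rfl, form_eq_dotProduct_stiffness Ψ hA hΩ hb hp, map_sub,
      Finsupp.coe_sub, ← hmul, ← extMatrix_mulVec Ψ w ⟨t, ht⟩, ← hR, ← Matrix.vecMul_transpose,
      ← Matrix.dotProduct_mulVec, Matrix.mulVec_sub, Matrix.mulVec_sub, hsolve, sub_self,
      dotProduct_zero]

/-- The error propagation of the preconditioned iteration contracts the energy norm. -/
theorem energy_contraction (Ψ : NodalBasis T p n) {A : E d → Matrix (Fin d) (Fin d) ℝ}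
    {α β : ℝ} (hA : IsElliptic Ω A α β) (hΩ : IsOpen Ω) (hreg : interior (closure Ω) = Ω)
    (hb : Bornology.IsBounded Ω) (hp : 1 ≤ p) (hpos : ∀ v : T.Vh p, form A Ω v v = 0 → v = 0)
    (D : Decomposition T M) (S : EigenSystem Ψ A D) {r : Fin M → ℕ}
    (w : ∀ i, Module.Basis (Fin (r i)) ℝ (T.Vh0 p (D.ωs i))) {s : ℕ}
    (wS : Module.Basis (Fin s) ℝ S.coarseSpace) (hLam : S.Lam ≠ ⊤) (x : Fin n → ℝ) :
    ((1 - preconditioner Ψ A D S w wS * stiffness Ψ A) *ᵥ x) ⬝ᵥ (stiffness Ψ A *ᵥ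
        ((1 - preconditioner Ψ A D S w wS * stiffness Ψ A) *ᵥ x)) ≤
      S.Lam.toReal ^ 2 * (x ⬝ᵥ (stiffness Ψ A *ᵥ x)) := by
  set v : T.Vh p := Ψ.basis.equivFun.symm x with hv
  have hx : ⇑(Ψ.basis.repr v) = x := by
    rw [← Module.Basis.equivFun_apply, hv, LinearEquiv.apply_symm_apply]
  choose u hu horth using fun i => exists_galerkin Ψ hA hΩ hb hp hpos (w i) v
  obtain ⟨t, ht, hle⟩ := S.exists_coarse_approx hΩ hreg hb hp hA hLam v (fun i => u i)
    (fun i => (u i).2) horth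
  set z : T.Vh p := v - ∑ i, localize Ψ D i (u i) with hz
  obtain ⟨y, hy, hyorth⟩ := exists_galerkin Ψ hA hΩ hb hp hpos wS z
  have hQ : oneLevel Ψ A D w *ᵥ (stiffness Ψ A *ᵥ x) =
      Ψ.basis.repr (∑ i, localize Ψ D i (u i : T.Vh p)) := by
    rw [map_sum, Finsupp.coe_finsetSum, oneLevel, Matrix.sum_mulVec]
    refine Finset.sum_congr rfl fun i _ => ?_
    rw [← pouMatrix_mulVec Ψ D i (w i), hu i, hx]
    simp only [Matrix.mulVec_mulVec, Matrix.mul_assoc]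
  have hzx : ⇑(Ψ.basis.repr z) = x - oneLevel Ψ A D w *ᵥ (stiffness Ψ A *ᵥ x) := by
    rw [hQ, hz, map_sub, Finsupp.coe_sub, hx]
  -- This is the factorization 1 - BA = (1 - P_S)(1 - QA): z represents (1 - QA)x and y is the
  -- coarse Galerkin projection of z.
  have hG : (1 - preconditioner Ψ A D S w wS * stiffness Ψ A) *ᵥ x =
      Ψ.basis.repr (z - y : T.Vh p) := by
    rw [map_sub, Finsupp.coe_sub, ← extMatrix_mulVec Ψ wS, hy, hzx, preconditioner,
      Matrix.sub_mulVec, Matrix.one_mulVec, ← Matrix.mulVec_mulVec, Matrix.add_mulVec,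
      ← Matrix.mulVec_mulVec, ← Matrix.mulVec_mulVec, ← Matrix.mulVec_mulVec, Matrix.sub_mulVec,
      Matrix.one_mulVec, ← Matrix.mulVec_mulVec, Matrix.mulVec_sub (stiffness Ψ A), sub_sub]
  rw [hG, ← form_eq_dotProduct_stiffness Ψ hA hΩ hb hp, ← hx,
    ← form_eq_dotProduct_stiffness Ψ hA hΩ hb hp]
  refine le_trans ?_ hle
  set a := formBilin T hΩ hb hp hA subset_rfl
  -- The Galerkin projection y is the best approximation of z in energy, hence at least as good as
  -- the t built from the eigenfunctions.
  have h1 : a (z - y) (y - t) = 0 := hyorth _ (Submodule.sub_mem _ y.2 ht)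
  have h2 : a (y - t) (z - y) = 0 := (hA.form_comm subset_rfl _ _).trans h1
  have h3 : 0 ≤ a (y - t) (y - t) := hA.form_self_nonneg subset_rfl _
  have h4 : z - t = (z - y) + (y - t) := by abel
  change a (z - y) (z - y) ≤ a (z - t) (z - t)
  rw [h4]
  simp only [map_add (f := a), LinearMap.add_apply, map_add (f := a _), h1, h2]
  linarith

end MatrixForm

/-! ### Krylov spaces and GMRES -/

section Krylov

variable {n : ℕ}

theorem krylov_mono (G : Matrix (Fin n) (Fin n) ℝ) (e : Fin n → ℝ) (j : ℕ) :
    krylov G e j ≤ krylov G e (j + 1) :=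
  Submodule.span_mono fun _ ⟨l, h1, h2, h3⟩ => ⟨l, h1, h2.trans (Nat.le_succ j), h3⟩

theorem mulVec_mem_krylov (G : Matrix (Fin n) (Fin n) ℝ) (e : Fin n → ℝ) (j : ℕ) {x : Fin n → ℝ}
    (hx : x ∈ krylov G e j) : G *ᵥ x ∈ krylov G e (j + 1) := by
  induction hx using Submodule.span_induction with
  | mem x hx =>
    obtain ⟨l, h1, h2, rfl⟩ := hx
    exact Submodule.subset_span ⟨l + 1, by omega, by omega, by
      rw [Matrix.mulVec_mulVec, ← pow_succ']⟩
  | zero => rw [Matrix.mulVec_zero]; exact Submodule.zero_mem _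
  | add x y _ _ hx hy => rw [Matrix.mulVec_add]; exact Submodule.add_mem _ hx hy
  | smul c x _ hx => rw [Matrix.mulVec_smul]; exact Submodule.smul_mem _ c hx

/-- The polynomial 1 - (1 - t)^j has degree at most j and no constant term. -/
theorem sub_pow_mulVec_mem_krylov (G : Matrix (Fin n) (Fin n) ℝ) (e : Fin n → ℝ) (j : ℕ) :
    e - ((1 - G) ^ j) *ᵥ e ∈ krylov G e j := by
  induction j with
  | zero => simp
  | succ j ih =>
    have h1 : G *ᵥ e ∈ krylov G e (j + 1) :=
      Submodule.subset_span ⟨1, le_rfl, by omega, by rw [pow_one]⟩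
    have h2 := mulVec_mem_krylov G e j ih
    have h3 := krylov_mono G e j ih
    have h4 : e - ((1 - G) ^ (j + 1)) *ᵥ e =
        (e - ((1 - G) ^ j) *ᵥ e) + G *ᵥ e - G *ᵥ (e - ((1 - G) ^ j) *ᵥ e) := by
      rw [pow_succ', ← Matrix.mulVec_mulVec, Matrix.sub_mulVec, Matrix.one_mulVec,
        Matrix.mulVec_sub]
      abel
    rw [h4]
    exact Submodule.sub_mem _ (Submodule.add_mem _ h3 h1) h2

/-- If `1 - G` contracts an energy norm that is equivalent to the Euclidean norm, the GMRES
residuals decay at the rate of the contraction. -/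
theorem IsGMRES.eucl_le {G K : Matrix (Fin n) (Fin n) ℝ} {u : Fin n → ℝ} {U : ℕ → Fin n → ℝ}
    (h : IsGMRES G u U) {Λ c₁ c₂ κ : ℝ} (hΛ : 0 ≤ Λ) (hc₁ : 0 < c₁) (hκ : c₂ ≤ κ * c₁)
    (hlow : ∀ x, c₁ * eucl x ^ 2 ≤ x ⬝ᵥ (K *ᵥ x)) (hup : ∀ x, x ⬝ᵥ (K *ᵥ x) ≤ c₂ * eucl x ^ 2)
    (hcon : ∀ x, ((1 - G) *ᵥ x) ⬝ᵥ (K *ᵥ ((1 - G) *ᵥ x)) ≤ Λ ^ 2 * (x ⬝ᵥ (K *ᵥ x)))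
    {k : ℕ} (hk : κ * (Λ ^ k) ^ 2 ≤ 1) (j : ℕ) :
    eucl (G *ᵥ (u - U (j + k))) ≤ Λ ^ j * eucl (G *ᵥ (u - U 0)) := by
  set e := u - U 0 with he
  -- The competitor is the stationary iterate with error (1 - G)^(j+k) e. As G commutes with 1 - G,
  -- the same power acts on the residual G e.
  have hmin := (h (j + k)).2 (u - ((1 - G) ^ (j + k)) *ᵥ e) (by
    have := sub_pow_mulVec_mem_krylov G e (j + k)
    rwa [show u - ((1 - G) ^ (j + k)) *ᵥ e - U 0 = e - ((1 - G) ^ (j + k)) *ᵥ e by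
      rw [he]; abel])
  rw [sub_sub_cancel] at hmin
  have hcomm : G *ᵥ (((1 - G) ^ (j + k)) *ᵥ e) = ((1 - G) ^ (j + k)) *ᵥ (G *ᵥ e) := by
    have : Commute G ((1 - G) ^ (j + k)) :=
      ((Commute.one_right G).sub_right (Commute.refl G)).pow_right _
    rw [Matrix.mulVec_mulVec, Matrix.mulVec_mulVec, this.eq]
  rw [hcomm] at hmin
  refine hmin.trans ?_
  set y := G *ᵥ e
  have hiter : ∀ m : ℕ, (((1 - G) ^ m) *ᵥ y) ⬝ᵥ (K *ᵥ (((1 - G) ^ m) *ᵥ y)) ≤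
      (Λ ^ m) ^ 2 * (y ⬝ᵥ (K *ᵥ y)) := by
    intro m
    induction m with
    | zero => simp
    | succ m ih =>
      rw [pow_succ' (1 - G), ← Matrix.mulVec_mulVec]
      refine (hcon _).trans ((mul_le_mul_of_nonneg_left ih (sq_nonneg Λ)).trans (le_of_eq ?_))
      ring
  have hy0 : 0 ≤ eucl y := norm_nonneg _
  refine le_of_sq_le_sq ?_ (by positivity)
  have h1 := (hlow _).trans ((hiter (j + k)).trans
    (mul_le_mul_of_nonneg_left (hup y) (sq_nonneg _)))
  refine le_of_mul_le_mul_left (h1.trans ?_) hc₁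
  -- Of the j + k contractions, k absorb the ratio c₂ / c₁ ≤ κ and j remain.
  calc (Λ ^ (j + k)) ^ 2 * (c₂ * eucl y ^ 2)
      ≤ (Λ ^ (j + k)) ^ 2 * (κ * c₁ * eucl y ^ 2) := by gcongr
    _ = (κ * (Λ ^ k) ^ 2) * (c₁ * (Λ ^ j * eucl y) ^ 2) := by ring
    _ ≤ 1 * (c₁ * (Λ ^ j * eucl y) ^ 2) := by gcongr
    _ = _ := one_mul _

end Krylov

/-! ### Mesh-size constants and the choice of k -/

namespace Triangulation

variable {d : ℕ} {Ω : Set (E d)}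

theorem le_of_closedBall_subset (hd : 0 < d) {c : E d} {r R : ℝ} (hr : 0 ≤ r)
    (h : Metric.closedBall c r ⊆ Metric.closedBall 0 R) : r ≤ R := by
  set e : E d := EuclideanSpace.single ⟨0, hd⟩ (1 : ℝ)
  have he : ‖r • e‖ = r := by simp [e, norm_smul, abs_of_nonneg hr]
  have h1 := h (show c + r • e ∈ Metric.closedBall c r by simp [he])
  have h2 := h (show c - r • e ∈ Metric.closedBall c r by simp [he])
  rw [mem_closedBall_zero_iff] at h1 h2
  have h3 := norm_sub_le (c + r • e) (c - r • e)
  have h4 : c + r • e - (c - r • e) = (2 : ℝ) • (r • e) := by rw [two_smul]; abel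
  rw [h4, norm_smul, he, Real.norm_of_nonneg zero_le_two] at h3
  linarith

theorem le_diam_of_closedBall_subset (hd : 0 < d) {c : E d} {r : ℝ} (hr : 0 ≤ r)
    {K : Finset (E d)} (h : Metric.closedBall c r ⊆ cell K) : r ≤ Metric.diam (cell K) := by
  set e : E d := EuclideanSpace.single ⟨0, hd⟩ (1 : ℝ)
  have he : ‖r • e‖ = r := by simp [e, norm_smul, abs_of_nonneg hr]
  have h1 := h (show c + r • e ∈ Metric.closedBall c r by simp [he])
  have h2 := h (show c ∈ Metric.closedBall c r by simpa using hr)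
  have h3 := Metric.dist_le_diam_of_mem (isCompact_cell K).isBounded h1 h2
  rwa [dist_eq_norm, add_sub_cancel_left, he] at h3

/-- On a shape regular and quasiuniform mesh every element contains a ball of radius comparable to
the mesh size. -/
theorem exists_closedBall_of_quasiUniform (T : Triangulation Ω) (hd : 0 < d) {σ q : ℝ}
    (hσ : T.ShapeRegular σ) (hq : T.QuasiUniform q) (hne : Ω.Nonempty) :
    0 < T.meshSize ∧ 0 < q * σ ∧
      ∀ K ∈ T.cells, ∃ c, Metric.closedBall c (T.meshSize / (q * σ)) ⊆ cell K := by
  have hcell : ∃ K, K ∈ T.cells := by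
    obtain ⟨x, hx⟩ := hne
    have := subset_closure hx
    rw [← T.cover] at this
    obtain ⟨K, hK, -⟩ := Set.mem_iUnion₂.1 this
    exact ⟨K, hK⟩
  have hle : ∀ K ∈ T.cells, Metric.diam (cell K) ≤ T.meshSize := fun K hK =>
    le_ciSup (f := fun K : T.cells => Metric.diam (cell (K : Finset (E d))))
      (Set.finite_range _).bddAbove ⟨K, hK⟩
  have hdiam : ∀ K ∈ T.cells, 0 < Metric.diam (cell K) := fun K hK => by
    obtain ⟨x, r, hr, hb, -⟩ := hσ K hK
    exact hr.trans_le (le_diam_of_closedBall_subset hd hr.le hb)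
  obtain ⟨K, hK⟩ := hcell
  have hh : 0 < T.meshSize := (hdiam K hK).trans_le (hle K hK)
  -- The signs of q and σ are forced by the existence of a cell of positive diameter.
  have hq0 : 0 < q := pos_of_mul_pos_left (hh.trans_le (hq K hK)) (hdiam K hK).le
  have hσ0 : 0 < σ := by
    obtain ⟨x, r, hr, -, hb⟩ := hσ K hK
    exact pos_of_mul_pos_left ((hdiam K hK).trans_le hb) hr.le
  refine ⟨hh, mul_pos hq0 hσ0, fun L hL => ?_⟩
  obtain ⟨x, r, hr, hb, hdr⟩ := hσ L hL
  refine ⟨x, (Metric.closedBall_subset_closedBall ?_).trans hb⟩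
  rw [div_le_iff₀ (mul_pos hq0 hσ0)]
  calc T.meshSize ≤ q * Metric.diam (cell L) := hq L hL
    _ ≤ q * (σ * r) := mul_le_mul_of_nonneg_left hdr hq0.le
    _ = r * (q * σ) := by ring

end Triangulation

/-- The number of iterations after which a contraction with factor `Λ ≤ θ` absorbs a condition
number that is polynomial in `1 / h`. -/
theorem exists_nat_absorbing {Λ θ B h K₀ : ℝ} (N : ℕ) (hΛ : 0 ≤ Λ) (hθ : Λ ≤ θ) (hθ0 : 0 < θ)
    (hθ1 : θ < 1) (hB : 1 ≤ B) (hh : 0 < h) (hK₀ : 1 ≤ K₀) :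
    ∃ k : ℕ, (k : ℝ) ≤ ((1 + Real.log K₀ + N) / (2 * Real.log (1 / θ)) + 1) *
        (Real.log B + max 1 (Real.log (1 / h))) ∧
      B * K₀ * (1 / h) ^ N * (Λ ^ k) ^ 2 ≤ 1 := by
  set m := max 1 (Real.log (1 / h)) with hm
  have hm1 : 1 ≤ m := le_max_left _ _
  set L := Real.log (1 / θ) with hL
  have hL0 : 0 < L := Real.log_pos ((one_lt_div hθ0).2 hθ1)
  have hlB : 0 ≤ Real.log B := Real.log_nonneg hB
  have hlK : 0 ≤ Real.log K₀ := Real.log_nonneg hK₀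
  set X := Real.log B + Real.log K₀ + N * m with hX
  have hX0 : 0 ≤ X := by positivity
  -- The logarithm of B K₀ h^(-N) is at most X, and 2k contractions by θ gain 2kL. The 1 lost by
  -- rounding up is absorbed since m ≥ 1.
  refine ⟨⌈X / (2 * L)⌉₊, ?_, ?_⟩
  · have h1 : (⌈X / (2 * L)⌉₊ : ℝ) ≤ X / (2 * L) + 1 := (Nat.ceil_lt_add_one (by positivity)).le
    have h2 : X ≤ (1 + Real.log K₀ + N) * (Real.log B + m) := by
      have h3 : Real.log K₀ ≤ Real.log K₀ * m := le_mul_of_one_le_right hlK hm1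
      have h4 : 0 ≤ Real.log K₀ * Real.log B := by positivity
      have h5 : 0 ≤ (N : ℝ) * Real.log B := by positivity
      rw [hX]; nlinarith
    have h6 : X / (2 * L) ≤ (1 + Real.log K₀ + N) / (2 * L) * (Real.log B + m) := by
      rw [div_mul_eq_mul_div]; gcongr
    rw [add_mul, one_mul]
    linarith
  · set k := ⌈X / (2 * L)⌉₊ with hk
    have h1 : X ≤ k * (2 * L) := (div_le_iff₀ (by positivity)).1 (Nat.le_ceil _)
    have hκ : B * K₀ * (1 / h) ^ N ≤ Real.exp X := by
      rw [hX, Real.exp_add, Real.exp_add, Real.exp_log (by linarith), Real.exp_log (by linarith),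
        Real.exp_nat_mul]
      have : 1 / h ≤ Real.exp m := by
        rw [← Real.exp_log (by positivity : 0 < 1 / h)]
        exact Real.exp_le_exp.2 (le_max_right _ _)
      gcongr
    have hθe : θ = Real.exp (-L) := by
      rw [hL, one_div, Real.log_inv, neg_neg, Real.exp_log hθ0]
    have hpow : (Λ ^ k) ^ 2 ≤ Real.exp (-X) := by
      calc (Λ ^ k) ^ 2 ≤ (θ ^ k) ^ 2 := by gcongr
        _ = Real.exp (-(k * (2 * L))) := by
          rw [hθe, ← Real.exp_nat_mul, ← Real.exp_nat_mul]; congr 1; push_cast; ring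
        _ ≤ _ := Real.exp_le_exp.2 (by linarith)
    calc B * K₀ * (1 / h) ^ N * (Λ ^ k) ^ 2 ≤ Real.exp X * Real.exp (-X) := by
          refine mul_le_mul hκ hpow (by positivity) (Real.exp_pos _).le
      _ = 1 := by rw [← Real.exp_add, add_neg_cancel, Real.exp_zero]

end MSGFEM

end


/-! ### Assembly of the corollary -/

open MSGFEM in
theorem corollary3p7 (d : ℕ) (hd : d = 2 ∨ d = 3) (Ω : Set (MSGFEM.E d))
    (hΩ_open : IsOpen Ω) (hΩ_bdd : Bornology.IsBounded Ω) (hΩ_reg : interior (closure Ω) = Ω)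
    (p : ℕ) (hp : 1 ≤ p) (σ q : ℝ) (Λ₀ : ℝ) (hΛ₀ : Λ₀ < 1) :
    ∃ C : ℝ, 0 < C ∧
      ∀ (T : MSGFEM.Triangulation Ω), T.ShapeRegular σ → T.QuasiUniform q →
      ∀ (n : ℕ) (Ψ : MSGFEM.NodalBasis T p n)
        (A : MSGFEM.E d → Matrix (Fin d) (Fin d) ℝ) (α β : ℝ), MSGFEM.IsElliptic Ω A α β →
      ∀ (M : ℕ) (D : MSGFEM.Decomposition T M) (S : MSGFEM.EigenSystem Ψ A D)
        (r : Fin M → ℕ) (w : ∀ i, Module.Basis (Fin (r i)) ℝ (T.Vh0 p (D.ωs i)))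
        (s : ℕ) (wS : Module.Basis (Fin s) ℝ S.coarseSpace),
        S.Lam ≤ ENNReal.ofReal Λ₀ →
        ∃ k : ℕ, (k : ℝ) ≤ C * (Real.log (β / α) + max 1 (Real.log (1 / T.meshSize))) ∧
          ∀ (ℓ : T.Vh p →ₗ[ℝ] ℝ) (u : Fin n → ℝ),
            MSGFEM.stiffness Ψ A *ᵥ u = (fun i => ℓ (Ψ.basis i)) →
          ∀ U : ℕ → Fin n → ℝ,
            MSGFEM.IsGMRES
              (MSGFEM.preconditioner Ψ A D S w wS * MSGFEM.stiffness Ψ A) u U →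
          ∀ j : ℕ,
            MSGFEM.eucl ((MSGFEM.preconditioner Ψ A D S w wS * MSGFEM.stiffness Ψ A) *ᵥ
                (u - U (j + k))) ≤
              S.Lam.toReal ^ j *
                MSGFEM.eucl ((MSGFEM.preconditioner Ψ A D S w wS * MSGFEM.stiffness Ψ A) *ᵥ
                  (u - U 0)) := by
  have hd0 : 0 < d := by omega
  obtain ⟨R, hR0, hR⟩ := hΩ_bdd.subset_closedBall_lt 0 0
  set c := inverseConst d p with hc
  have hc0 : 0 < c := inverseConst_pos d hp
  set κ := volume.real (Metric.ball (0 : E d) 1) with hκ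
  have hκ0 : 0 < κ := ENNReal.toReal_pos (Metric.measure_ball_pos _ _ one_pos).ne'
    Metric.isBounded_ball.measure_lt_top.ne
  set V := volume.real Ω with hV
  have hV0 : 0 ≤ V := measureReal_nonneg
  -- This is c₂ / c₁ without β / α and h^(-(2d+2)), for the spectral bounds taken at ball radius h /
  -- (qσ). The exponent consists of 2d from c₁ and 2 from c₂. It is fixed before the mesh, so `max 1
  -- K₁` is used later to keep the logarithm nonnegative.
  set K₁ := d * c ^ 2 * V * (16 * R ^ 2 * (2 * R) ^ d) * ((2 * c) ^ d) ^ 2 / κ *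
    (q * σ) ^ (2 * d + 2) with hK₁
  -- Since Λ₀ may be zero or negative, the contraction factor is weakened to at least 1/2, which
  -- keeps log (1 / θ) finite and positive.
  set θ := max Λ₀ (1 / 2) with hθ
  have hθ0 : 0 < θ := lt_of_lt_of_le (by norm_num) (le_max_right _ _)
  have hθ1 : θ < 1 := max_lt hΛ₀ (by norm_num)
  have hL0 : 0 < Real.log (1 / θ) := Real.log_pos ((one_lt_div hθ0).2 hθ1)
  have hK₀ : 1 ≤ max 1 K₁ := le_max_left _ _
  have hlK := Real.log_nonneg hK₀
  refine ⟨(1 + Real.log (max 1 K₁) + (2 * d + 2 : ℕ)) / (2 * Real.log (1 / θ)) + 1,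
    by positivity, ?_⟩
  intro T hσ hq n Ψ A α β hA M D S r w s wS hLam
  have hα := hA.pos
  have hβα : 1 ≤ β / α := (one_le_div hα).2 hA.le
  -- For empty Ω there are no nodes, all vectors are empty and k = 0 works. Otherwise the mesh has a
  -- cell and h > 0.
  rcases Ω.eq_empty_or_nonempty with hE | hne
  · have hn : IsEmpty (Fin n) := ⟨fun k =>
      Set.eq_empty_iff_forall_notMem.1 hE _ (Ψ.node k).2.1⟩
    have h0 : ∀ x : Fin n → ℝ, eucl x = 0 := fun x => by
      have := eucl_sq x
      rw [Finset.univ_eq_empty, Finset.sum_empty] at this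
      exact pow_eq_zero_iff two_ne_zero |>.1 this
    refine ⟨0, ?_, fun _ _ _ _ _ j => by rw [h0, h0, mul_zero]⟩
    have := Real.log_nonneg hβα
    have h1 : 0 ≤ max 1 (Real.log (1 / T.meshSize)) := zero_le_one.trans (le_max_left _ _)
    rw [Nat.cast_zero]
    positivity
  obtain ⟨hh, hqσ, hball⟩ := T.exists_closedBall_of_quasiUniform hd0 hσ hq hne
  set h := T.meshSize with hhdef
  set ρ := h / (q * σ) with hρ
  have hρ0 : 0 < ρ := div_pos hh hqσ
  have hρR : ρ ≤ R := by
    obtain ⟨x, hx⟩ := hne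
    have hx' := subset_closure hx
    rw [← T.cover] at hx'
    obtain ⟨K, hK, -⟩ := Set.mem_iUnion₂.1 hx'
    obtain ⟨y, hy⟩ := hball K hK
    refine Triangulation.le_of_closedBall_subset hd0 hρ0.le (hy.trans ?_)
    have hKΩ : cell K ⊆ closure Ω := by
      rw [← T.cover]
      exact Set.subset_biUnion_of_mem (u := fun K => cell K) hK
    exact hKΩ.trans (closure_minimal hR Metric.isClosed_closedBall)
  have hlamtop : S.Lam ≠ ⊤ := (hLam.trans_lt ENNReal.ofReal_lt_top).ne
  have hlamle : S.Lam.toReal ≤ θ := by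
    refine (ENNReal.toReal_mono ENNReal.ofReal_ne_top hLam).trans ?_
    rw [ENNReal.toReal_ofReal']
    exact max_le (le_max_left _ _) hθ0.le
  obtain ⟨k, hk1, hk2⟩ := exists_nat_absorbing (2 * d + 2) ENNReal.toReal_nonneg hlamle hθ0 hθ1 hβα
    hh hK₀
  refine ⟨k, hk1, fun ℓ u _ U hU j => ?_⟩
  have hlow := hA.eucl_sq_le_form Ψ hd0 hΩ_open hΩ_reg hΩ_bdd hp hρ0 hρR hball hR
  have hup := hA.form_le_eucl_sq Ψ hΩ_open hΩ_bdd hp hρ0 hball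
  rw [← hc, ← hκ] at hlow
  rw [← hc, ← hV] at hup
  have hc₁ : 0 < α * κ * ((ρ / (2 * c)) ^ d) ^ 2 / (16 * R ^ 2 * (2 * R) ^ d) := by positivity
  -- Definiteness of the energy form is a by-product of the lower spectral bound.
  have hpos : ∀ v : T.Vh p, form A Ω v v = 0 → v = 0 := fun v hv => by
    have h1 := hlow v
    rw [hv, eucl_sq] at h1
    have h2 := nonpos_of_mul_nonpos_right h1 hc₁
    have h3 := (Finset.sum_eq_zero_iff_of_nonneg (fun _ _ => sq_nonneg _)).1
      (h2.antisymm (Finset.sum_nonneg fun _ _ => sq_nonneg _))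
    refine Ψ.ext fun k => ?_
    simpa using h3 k (Finset.mem_univ k)
  have hvec : ∀ x : Fin n → ℝ, ∃ v : T.Vh p, (fun k => (v : E d → ℝ) (Ψ.node k)) = x ∧
      form A Ω v v = x ⬝ᵥ (stiffness Ψ A *ᵥ x) := fun x => by
    have h1 : ⇑(Ψ.basis.repr (Ψ.basis.equivFun.symm x)) = x := by
      rw [← Module.Basis.equivFun_apply, LinearEquiv.apply_symm_apply]
    refine ⟨Ψ.basis.equivFun.symm x, ?_, ?_⟩
    · funext k
      rw [← Ψ.repr_apply, h1]
    · rw [form_eq_dotProduct_stiffness Ψ hA hΩ_open hΩ_bdd hp, h1]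
  refine hU.eucl_le (K := stiffness Ψ A) ENNReal.toReal_nonneg hc₁
    (c₂ := β * (d * (c / ρ) ^ 2) * V) ?_ ?_ ?_ ?_ hk2 j
  · have hK : (β / α) * K₁ * (1 / h) ^ (2 * d + 2) *
        (α * κ * ((ρ / (2 * c)) ^ d) ^ 2 / (16 * R ^ 2 * (2 * R) ^ d)) =
        β * (d * (c / ρ) ^ 2) * V := by
      have e1 : (q * σ) ^ (2 * d + 2) * (1 / h) ^ (2 * d + 2) = ((1 / ρ) ^ d) ^ 2 * (1 / ρ) ^ 2 := by
        rw [← mul_pow, ← pow_mul, ← pow_add, mul_comm d 2, hρ]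
        congr 1
        field_simp
      calc _ = (β / α) * (d * c ^ 2 * V * (16 * R ^ 2 * (2 * R) ^ d) * ((2 * c) ^ d) ^ 2 / κ) *
            ((q * σ) ^ (2 * d + 2) * (1 / h) ^ (2 * d + 2)) *
            (α * κ * ((ρ / (2 * c)) ^ d) ^ 2 / (16 * R ^ 2 * (2 * R) ^ d)) := by rw [hK₁]; ring
        _ = _ := by
          rw [e1]
          simp only [div_pow, one_pow, mul_pow]
          field_simp
    rw [← hK]
    have : K₁ ≤ max 1 K₁ := le_max_right _ _
    gcongr
  · intro x
    obtain ⟨v, rfl, e⟩ := hvec x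
    rw [← e]; exact hlow v
  · intro x
    obtain ⟨v, rfl, e⟩ := hvec x
    rw [← e]; exact hup v
  · exact energy_contraction Ψ hA hΩ_open hΩ_reg hΩ_bdd hp hpos D S w wS hlamtop
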